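/- Let $d \ge 0$ and $N \ge 2$ be integers, and let $\mathsf{A} = (A_1,\ldots,A_N) \in GL_d(\mathbb{R})^N$. For a real $d\times d$ matrix $B$ let $\alpha_1(B) \ge \cdots \ge \alpha_d(B)$ be its singular values, and for $0 \le s \le d$ let $$\varphi^s(B) = \alpha_1(B)\cdots\alpha_{\lfloor s\rfloor}(B)\,\alpha_{\lceil s\rceil}(B)^{s-\lfloor s\rfloor}.$$ Write $\Sigma_n = \{1,\ldots,N\}^n$, $A_{\mathtt{i}} = A_{i_1}\cdots A_{i_n}$ for $\mathtt{i} = i_1\cdots i_n \in \Sigma_n$, and define the singular value pressure $$P_{\mathsf{A}}(\varphi^s) = \lim_{n\to\infty} \tfrac1n \log \sum_{\mathtt{i}\in\Sigma_n} \varphi^s(A_{\mathtt{i}}).$$ The affinity dimension $\dim_{\mathrm{aff}}(\mathsf{A})$ is the smallest $s \in [0,d]$ with $P_{\mathsf{A}}(\varphi^s)=0$ if such an $s$ exists, and $d$ otherwise. (If every $A_i$ is a contraction in the Euclidean norm, the pressure is strictly decreasing in $s$, so there is at most one such $s$.) Both notions are defined in the same way for a tuple of $N-1$ matrices. For a shift-invariant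 Borel probability measure $\mu$ on $\{1,\ldots,N\}^{\mathbb{N}}$, with $[\mathtt{i}]$ denoting the set of infinite words beginning with $\mathtt{i}$, put $$h(\mu) = \lim_{n\to\infty}\tfrac1n\sum_{\mathtt{i}\in\Sigma_n} -\mu([\mathtt{i}])\log\mu([\mathtt{i}]), \qquad \lambda_{\mathsf{A}}(\varphi^s,\mu) = \lim_{n\to\infty}\tfrac1n\sum_{\mathtt{i}\in\Sigma_n}\mu([\mathtt{i}])\log\varphi^s(A_{\mathtt{i}}).$$ The measure $\mu$ is a $\varphi^s$-equilibrium state of $\mathsf{A}$ if $P_{\mathsf{A}}(\varphi^s) = h(\mu)+\lambda_{\mathsf{A}}(\varphi^s,\mu)$, and it is fully supported if $\mu([\mathtt{i}])>0$ for every finite word $\mathtt{i}$. Let $1 \le j \le N$ and let $\mathsf{A}'$ be the $(N-1)$-tuple obtained from $\mathsf{A}$ by deleting $A_j$. 1. If $0 \le s \le d$ and all $\varphi^s$-equilibrium states of $\mathsf{A}$ are fully supported, then $P_{\mathsf{A}'}(\varphi^s) < P_{\mathsf{A}}(\varphi^s)$. 2. If $P_{\mathsf{A}}(\varphi^d) \le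 0$ and, for $s = \dim_{\mathrm{aff}}(\mathsf{A})$, all $\varphi^s$-equilibrium states of $\mathsf{A}$ are fully supported, then $\dim_{\mathrm{aff}}(\mathsf{A}') < \dim_{\mathrm{aff}}(\mathsf{A})$. -/

import Mathlib

open MeasureTheory Filter

noncomputable section

namespace AffinityPressure

/-- The singular value function `φ^s(A) = α₁(A) ⋯ α_k(A) · α_{k+1}(A)^(s-k)` with `k = ⌊s⌋`, for
`0 ≤ s ≤ d`. Mathlib's singular values are listed in decreasing order with multiplicity and indexed
from `0`, so `α_{i+1}(A)` is the one with index `i`. If `s` is an integer, then the last factor has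
exponent `0` and equals `1`. -/
def singularValueFunction {d : ℕ} (s : ℝ) (A : Matrix (Fin d) (Fin d) ℝ) : ℝ :=
  (∏ i ∈ Finset.range ⌊s⌋₊, (Matrix.toEuclideanLin A).singularValues i) *
    (Matrix.toEuclideanLin A).singularValues ⌊s⌋₊ ^ (s - (⌊s⌋₊ : ℝ))

/-- The product `A_{w₁} A_{w₂} ⋯ A_{w_n}` along a word `w` of length `n`. -/
def wordProd {d N : ℕ} (A : Fin N → GL (Fin d) ℝ) {n : ℕ} (w : Fin n → Fin N) :
    Matrix (Fin d) (Fin d) ℝ :=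
  (List.ofFn fun k => (A (w k) : Matrix (Fin d) (Fin d) ℝ)).prod

/-- The singular value pressure `P_A(φ^s) = lim (1/n) log ∑_{|w| = n} φ^s(A_w)`. -/
def pressure {d N : ℕ} (A : Fin N → GL (Fin d) ℝ) (s : ℝ) : ℝ :=
  limUnder atTop fun n : ℕ =>
    (1 / (n : ℝ)) * Real.log (∑ w : Fin n → Fin N, singularValueFunction s (wordProd A w))

/-- The affinity dimension: the smallest zero of `s ↦ P_A(φ^s)` in `[0, d]`, and `d` if there is no
zero. If all the matrices are contractions, then the pressure is strictly decreasing in `s`, and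
there is at most one zero. -/
def affinityDim {d N : ℕ} (A : Fin N → GL (Fin d) ℝ) : ℝ :=
  sInf ({s : ℝ | 0 ≤ s ∧ s ≤ (d : ℝ) ∧ pressure A s = 0} ∪ {(d : ℝ)})

/-- The left shift on infinite words. -/
def shift {N : ℕ} (x : ℕ → Fin N) : ℕ → Fin N := fun n => x (n + 1)

/-- The cylinder set of infinite words that begin with `w`. -/
def cylinder {N n : ℕ} (w : Fin n → Fin N) : Set (ℕ → Fin N) :=
  {x | ∀ k : Fin n, x k = w k}

/-- `h(μ) = lim (1/n) ∑_{|w| = n} -μ[w] log μ[w]`, the entropy of a shift-invariant measure. -/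
def entropy {N : ℕ} (μ : Measure (ℕ → Fin N)) : ℝ :=
  limUnder atTop fun n : ℕ =>
    (1 / (n : ℝ)) * ∑ w : Fin n → Fin N,
      -(μ.real (cylinder w) * Real.log (μ.real (cylinder w)))

/-- `λ_A(φ^s, μ) = lim (1/n) ∑_{|w| = n} μ[w] log φ^s(A_w)`. -/
def lyapunov {d N : ℕ} (A : Fin N → GL (Fin d) ℝ) (s : ℝ) (μ : Measure (ℕ → Fin N)) : ℝ :=
  limUnder atTop fun n : ℕ =>
    (1 / (n : ℝ)) * ∑ w : Fin n → Fin N,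
      μ.real (cylinder w) * Real.log (singularValueFunction s (wordProd A w))

/-- `μ` is a `φ^s`-equilibrium state of `A`: a shift-invariant Borel probability measure on the
space of infinite words with `P_A(φ^s) = h(μ) + λ_A(φ^s, μ)`. -/
structure IsEquilibriumState {d N : ℕ} (A : Fin N → GL (Fin d) ℝ) (s : ℝ)
    (μ : Measure (ℕ → Fin N)) : Prop where
  isProbabilityMeasure : IsProbabilityMeasure μ
  invariant : MeasurePreserving shift μ μ
  variational : pressure A s = entropy μ + lyapunov A s μ

/-- A measure is fully supported if every cylinder set has positive measure. -/
def FullySupported {N : ℕ} (μ : Measure (ℕ → Fin N)) : Prop :=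
  ∀ (n : ℕ) (w : Fin n → Fin N), 0 < μ (cylinder w)

/-- The tuple obtained from `A` by deleting the matrix with index `j`. -/
def deleteMatrix {d N : ℕ} (A : Fin (N + 1) → GL (Fin d) ℝ) (j : Fin (N + 1)) :
    Fin N → GL (Fin d) ℝ := fun i => A (j.succAbove i)

end AffinityPressure

end

/-! The reduced tuple has an equilibrium state. Viewed as a measure on the words that avoid `j`, it
keeps its invariance, entropy and Lyapunov exponent, but the cylinder of the letter `j` has mass
zero (`exists_invariant_not_fullySupported`). Deleting a matrix only removes positive terms from the
partition sums, so the pressure cannot grow. If it stayed the same, this measure would be an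
equilibrium state of `A` without full support.

For the dimension, the pressure is Lipschitz in `s` on `[0, d]` and nonnegative at `0`, so under the
hypothesis at `d` the affinity dimension of `A` is a zero of its pressure. There the reduced
pressure is negative, and the intermediate value theorem gives it a strictly smaller zero.

Most of the work is `exists_equilibrium`, for subadditive potentials with linear bounds: take Gibbs
weights on words of length `n`, extend them to infinite words, average over `n` shifts and pass to a
weak limit. Subadditivity of entropy and potential bounds entropy plus energy on every fixed window
from below.

Subadditivity of `log φ^s` comes from volumes: the product of the `k` largest singular values is the
largest growth factor of `k`-dimensional volume, and `φ^s` interpolates geometrically between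
consecutive such products. -/

noncomputable section

namespace AffinityPressure

/-! ### Products of singular values as maximal volume growth -/

open Matrix in
/-- The Cauchy-Binet formula, as a sum over all functions. -/
theorem factorial_mul_det_mul {d k : ℕ} (M : Matrix (Fin k) (Fin d) ℝ)
    (N : Matrix (Fin d) (Fin k) ℝ) :
    (k.factorial : ℝ) * (M * N).det =
      ∑ f : Fin k → Fin d, (M.submatrix id f).det * (N.submatrix f id).det := by
  have h1 : (M * N).det = ∑ f : Fin k → Fin d, (∏ i, M i (f i)) * (N.submatrix f id).det := by
    have h : M * N = fun i => ∑ j, M i j • N j := by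
      ext i l
      simp [Matrix.mul_apply, Finset.sum_apply]
    have h2 := (detRowAlternating (R := ℝ) (n := Fin k)).toMultilinearMap.map_sum
      (fun (i : Fin k) (j : Fin d) => M i j • N j)
    rw [h]
    refine h2.trans (Finset.sum_congr rfl fun f _ => ?_)
    exact (detRowAlternating (R := ℝ) (n := Fin k)).toMultilinearMap.map_smul_univ
      (fun i => M i (f i)) (fun i => N (f i))
  have h2 : ∀ σ : Equiv.Perm (Fin k), (M * N).det =
      ∑ f : Fin k → Fin d, ((Equiv.Perm.sign σ : ℤ) : ℝ) * (∏ i, M i (f (σ i))) *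
        (N.submatrix f id).det := by
    intro σ
    rw [h1, ← (Equiv.arrowCongr σ.symm (Equiv.refl (Fin d))).sum_comp]
    refine Finset.sum_congr rfl fun f _ => ?_
    have h3 : (N.submatrix ((Equiv.arrowCongr σ.symm (Equiv.refl (Fin d))) f) id) =
        (N.submatrix f id).submatrix σ id := by
      ext a b; simp [Equiv.arrowCongr]
    rw [h3, Matrix.det_permute]
    simp [Equiv.arrowCongr]
    ring
  calc (k.factorial : ℝ) * (M * N).det = ∑ σ : Equiv.Perm (Fin k), (M * N).det := by
        simp [Fintype.card_perm]
    _ = _ := by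
        rw [Finset.sum_congr rfl fun σ _ => h2 σ, Finset.sum_comm]
        refine Finset.sum_congr rfl fun f _ => ?_
        rw [← Finset.sum_mul, ← Matrix.det_transpose (M.submatrix id f),
          Matrix.det_apply' (M.submatrix id f)ᵀ]
        simp only [transpose_apply, submatrix_apply, id]

theorem prod_le_prod_range_of_antitone {e : ℕ → ℝ} (he : Antitone e) (h0 : ∀ i, 0 ≤ e i) :
    ∀ s : Finset ℕ, ∏ i ∈ s, e i ≤ ∏ i ∈ Finset.range s.card, e i := by
  intro s
  induction s using Finset.induction_on_max with
  | empty => simp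
  | insert a s hs ih =>
    have ha : a ∉ s := fun h => lt_irrefl _ (hs a h)
    rw [Finset.prod_insert ha, Finset.card_insert_of_notMem ha, Finset.prod_range_succ, mul_comm]
    have hc : s.card ≤ a := by
      have : s ⊆ Finset.range a := fun x hx => Finset.mem_range.2 (hs x hx)
      simpa using Finset.card_le_card this
    exact mul_le_mul ih (he hc) (h0 _) (Finset.prod_nonneg fun i _ => h0 i)

-- Cauchy-Binet turns both sides into sums of squared minors of `Y`. The left one carries the weight
-- `∏ e (f a)`, which for injective `f` is a product over `k` distinct indices; the other minors
-- vanish.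
open Matrix in
theorem det_transpose_mul_diagonal_mul_le {d k : ℕ} {e : ℕ → ℝ} (he : Antitone e)
    (h0 : ∀ i, 0 ≤ e i) (Y : Matrix (Fin d) (Fin k) ℝ) :
    (Yᵀ * (diagonal (fun i : Fin d => e i) * Y)).det ≤
      (∏ i ∈ Finset.range k, e i) * (Yᵀ * Y).det := by
  have hk : (0 : ℝ) < k.factorial := by exact_mod_cast k.factorial_pos
  refine le_of_mul_le_mul_left ?_ hk
  rw [mul_left_comm, factorial_mul_det_mul, factorial_mul_det_mul, Finset.mul_sum]
  refine Finset.sum_le_sum fun f _ => ?_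
  have h1 : (Yᵀ.submatrix id f) = (Y.submatrix f id)ᵀ := rfl
  have h2 : ((diagonal (fun i : Fin d => e i) * Y).submatrix f id) =
      diagonal (fun a : Fin k => e (f a)) * Y.submatrix f id := by
    ext a b; simp [diagonal_mul]
  rw [h1, h2, det_transpose, det_mul, det_diagonal]
  by_cases hf : Function.Injective f
  · have h3 : ∏ a, e (f a) ≤ ∏ i ∈ Finset.range k, e i := by
      have := prod_le_prod_range_of_antitone he h0
        (Finset.univ.map ⟨fun a => (f a : ℕ), fun a b h => hf (Fin.ext h)⟩)
      rw [Finset.prod_map, Finset.card_map, Finset.card_univ, Fintype.card_fin] at this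
      exact this
    nlinarith [mul_self_nonneg (Y.submatrix f id).det]
  · have h4 : (Y.submatrix f id).det = 0 := by
      simp only [Function.Injective, not_forall] at hf
      obtain ⟨a, b, hab, hne⟩ := hf
      exact det_zero_of_row_eq hne (by ext c; simp [hab])
    simp [h4]

open Matrix in
/-- A frame of right singular vectors. -/
theorem exists_singular_frame {d : ℕ} (A : Matrix (Fin d) (Fin d) ℝ) :
    ∃ V : Matrix (Fin d) (Fin d) ℝ, Vᵀ * V = 1 ∧
      Vᵀ * (Aᵀ * A) * V =
        diagonal (fun i : Fin d => ((toEuclideanLin A).singularValues i) ^ 2) := by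
  set T := toEuclideanLin A with hT
  have hn : Module.finrank ℝ (EuclideanSpace ℝ (Fin d)) = d := by simp
  let b := T.isSymmetric_adjoint_comp_self.eigenvectorBasis hn
  have hb : ∀ i j, inner ℝ (b i) (b j) = if i = j then (1 : ℝ) else 0 :=
    orthonormal_iff_ite.1 b.orthonormal
  have hin : ∀ x y : EuclideanSpace ℝ (Fin d), inner ℝ x y = ∑ a, x a * y a := by
    intro x y
    simp [PiLp.inner_apply, mul_comm]
  refine ⟨Matrix.of fun i j => b j i, ?_, ?_⟩
  · ext i j
    rw [Matrix.one_apply, ← hb i j, hin]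
    simp [Matrix.mul_apply]
  · have hA : ∀ j a, (A * Matrix.of fun i j => b j i) a j = T (b j) a := by
      intro j a
      simp [hT, Matrix.mul_apply, toEuclideanLin, Matrix.toLpLin_apply, Matrix.mulVec, dotProduct]
    have h1 : (Matrix.of fun i j => b j i)ᵀ * (Aᵀ * A) * (Matrix.of fun i j => b j i) =
        (A * Matrix.of fun i j => b j i)ᵀ * (A * Matrix.of fun i j => b j i) := by
      rw [transpose_mul]; simp only [Matrix.mul_assoc]
    rw [h1]
    ext i j
    rw [Matrix.mul_apply, Matrix.diagonal_apply]
    simp only [transpose_apply, hA]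
    rw [← hin, ← LinearMap.adjoint_inner_right]
    have h2 : T.adjoint (T (b j)) =
        T.isSymmetric_adjoint_comp_self.eigenvalues hn j • b j :=
      T.isSymmetric_adjoint_comp_self.apply_eigenvectorBasis hn j
    rw [h2, inner_smul_right, hb, T.sq_singularValues_fin hn]
    split_ifs with h <;> simp [h]

/-- The product of the `k` largest singular values. -/
def singularProd {d : ℕ} (k : ℕ) (A : Matrix (Fin d) (Fin d) ℝ) : ℝ :=
  ∏ i ∈ Finset.range k, (Matrix.toEuclideanLin A).singularValues i

theorem singularProd_nonneg {d : ℕ} (k : ℕ) (A : Matrix (Fin d) (Fin d) ℝ) :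
    0 ≤ singularProd k A :=
  Finset.prod_nonneg fun i _ => LinearMap.singularValues_nonneg _ i

open Matrix in
theorem det_gram_mul_le {d k : ℕ} (A : Matrix (Fin d) (Fin d) ℝ) (X : Matrix (Fin d) (Fin k) ℝ) :
    ((A * X)ᵀ * (A * X)).det ≤ singularProd k A ^ 2 * (Xᵀ * X).det := by
  obtain ⟨V, hV, hD⟩ := exists_singular_frame A
  have hV' : V * Vᵀ = 1 := mul_eq_one_comm.1 hV
  have h := det_transpose_mul_diagonal_mul_le (d := d) (k := k)
    (e := fun i => ((toEuclideanLin A).singularValues i) ^ 2)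
    (fun i j hij => pow_le_pow_left₀ (LinearMap.singularValues_nonneg _ _)
      (LinearMap.singularValues_antitone _ hij) 2) (fun i => sq_nonneg _) (Vᵀ * X)
  rw [← hD, Finset.prod_pow] at h
  have h1 : (Vᵀ * X)ᵀ * (Vᵀ * (Aᵀ * A) * V * (Vᵀ * X)) = (A * X)ᵀ * (A * X) := by
    calc (Vᵀ * X)ᵀ * (Vᵀ * (Aᵀ * A) * V * (Vᵀ * X))
        = Xᵀ * (V * Vᵀ) * (Aᵀ * A) * (V * Vᵀ) * X := by
          rw [transpose_mul, transpose_transpose]; simp only [Matrix.mul_assoc]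
      _ = _ := by rw [hV', transpose_mul]; simp only [Matrix.mul_assoc, Matrix.one_mul]
  have h2 : (Vᵀ * X)ᵀ * (Vᵀ * X) = Xᵀ * X := by
    calc (Vᵀ * X)ᵀ * (Vᵀ * X) = Xᵀ * (V * Vᵀ) * X := by
          rw [transpose_mul, transpose_transpose]; simp only [Matrix.mul_assoc]
      _ = _ := by rw [hV', Matrix.mul_one]
  rw [h1, h2] at h
  exact h

-- The first `k` right singular vectors attain the bound of `det_gram_mul_le`.
open Matrix in
theorem exists_det_gram_mul_eq {d k : ℕ} (hk : k ≤ d) (A : Matrix (Fin d) (Fin d) ℝ) :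
    ∃ X : Matrix (Fin d) (Fin k) ℝ, Xᵀ * X = 1 ∧
      ((A * X)ᵀ * (A * X)).det = singularProd k A ^ 2 := by
  obtain ⟨V, hV, hD⟩ := exists_singular_frame A
  refine ⟨V.submatrix id (Fin.castLE hk), ?_, ?_⟩
  · have : (V.submatrix id (Fin.castLE hk))ᵀ * (V.submatrix id (Fin.castLE hk)) =
        (Vᵀ * V).submatrix (Fin.castLE hk) (Fin.castLE hk) := by
      ext i j; simp [Matrix.mul_apply]
    rw [this, hV, submatrix_one _ (Fin.castLE_injective hk)]
  · have : (A * V.submatrix id (Fin.castLE hk))ᵀ * (A * V.submatrix id (Fin.castLE hk)) =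
        (Vᵀ * (Aᵀ * A) * V).submatrix (Fin.castLE hk) (Fin.castLE hk) := by
      have h1 : Vᵀ * (Aᵀ * A) * V = (A * V)ᵀ * (A * V) := by
        rw [transpose_mul]; simp only [Matrix.mul_assoc]
      rw [h1]
      ext i j; simp [Matrix.mul_apply]
    rw [this, hD, submatrix_diagonal _ _ (Fin.castLE_injective hk), det_diagonal, singularProd,
      ← Finset.prod_pow, Finset.prod_range]
    simp

/-- Take a frame whose volume `A * B` expands the most, and bound the expansion by `B` and then by
`A` separately. -/
theorem singularProd_mul_le {d k : ℕ} (hk : k ≤ d) (A B : Matrix (Fin d) (Fin d) ℝ) :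
    singularProd k (A * B) ≤ singularProd k A * singularProd k B := by
  obtain ⟨X, hX, h⟩ := exists_det_gram_mul_eq hk (A * B)
  refine le_of_sq_le_sq ?_ (mul_nonneg (singularProd_nonneg _ _) (singularProd_nonneg _ _))
  rw [← h, mul_pow, Matrix.mul_assoc]
  refine (det_gram_mul_le A (B * X)).trans ?_
  refine mul_le_mul_of_nonneg_left ?_ (sq_nonneg _)
  simpa [hX] using det_gram_mul_le B X

theorem singularProd_one {d k : ℕ} (hk : k ≤ d) :
    singularProd k (1 : Matrix (Fin d) (Fin d) ℝ) = 1 := by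
  obtain ⟨X, hX, h⟩ := exists_det_gram_mul_eq hk (1 : Matrix (Fin d) (Fin d) ℝ)
  rw [Matrix.one_mul, hX, Matrix.det_one] at h
  exact (pow_eq_one_iff_of_nonneg (singularProd_nonneg _ _) two_ne_zero).1 h.symm

theorem singularProd_pos {d k : ℕ} (hk : k ≤ d) (g : GL (Fin d) ℝ) :
    0 < singularProd k (g : Matrix (Fin d) (Fin d) ℝ) := by
  refine (singularProd_nonneg _ _).lt_of_ne fun h => ?_
  have h1 := singularProd_mul_le hk (g : Matrix (Fin d) (Fin d) ℝ)
    ((g⁻¹ : GL (Fin d) ℝ) : Matrix (Fin d) (Fin d) ℝ)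
  rw [← Units.val_mul, mul_inv_cancel, Units.val_one, singularProd_one hk, ← h, zero_mul] at h1
  linarith

theorem singularValues_pos_of_lt {d i : ℕ} (hi : i < d) (g : GL (Fin d) ℝ) :
    0 < (Matrix.toEuclideanLin (g : Matrix (Fin d) (Fin d) ℝ)).singularValues i := by
  refine (LinearMap.singularValues_nonneg _ _).lt_of_ne fun h => ?_
  have h1 := singularProd_pos (Nat.succ_le_of_lt hi) g
  rw [singularProd, Finset.prod_range_succ, ← h, mul_zero] at h1
  exact lt_irrefl _ h1

/-! ### The singular value function: submultiplicativity and dependence on the exponent -/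

/-- The case `s = d` is separate because index `⌊s⌋₊ = d` lies beyond the last of the `d` singular
values; there the last factor is a power with exponent `0`. -/
theorem floor_lt_or_eq {d : ℕ} {s : ℝ} (h0 : 0 ≤ s) (hs : s ≤ d) : ⌊s⌋₊ < d ∨ s = d := by
  rcases hs.lt_or_eq with h | h
  · exact Or.inl ((Nat.floor_lt h0).2 h)
  · exact Or.inr h

theorem singularValueFunction_natCast {d : ℕ} (k : ℕ) (B : Matrix (Fin d) (Fin d) ℝ) :
    singularValueFunction (k : ℝ) B = singularProd k B := by
  simp [singularValueFunction, singularProd]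

theorem singularValueFunction_pos {d : ℕ} {s : ℝ} (h0 : 0 ≤ s) (hs : s ≤ d) (g : GL (Fin d) ℝ) :
    0 < singularValueFunction s (g : Matrix (Fin d) (Fin d) ℝ) := by
  rcases floor_lt_or_eq h0 hs with h | rfl
  · exact mul_pos (singularProd_pos h.le g) (Real.rpow_pos_of_pos (singularValues_pos_of_lt h g) _)
  · rw [singularValueFunction_natCast]
    exact singularProd_pos le_rfl g

theorem log_singularValueFunction_of_floor_lt {d : ℕ} {s : ℝ} (h : ⌊s⌋₊ < d) (g : GL (Fin d) ℝ) :
    Real.log (singularValueFunction s (g : Matrix (Fin d) (Fin d) ℝ)) =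
      (1 - (s - ⌊s⌋₊)) * Real.log (singularProd ⌊s⌋₊ (g : Matrix (Fin d) (Fin d) ℝ)) +
      (s - ⌊s⌋₊) * Real.log (singularProd (⌊s⌋₊ + 1) (g : Matrix (Fin d) (Fin d) ℝ)) := by
  have h1 := singularProd_pos h.le g
  have h2 := singularValues_pos_of_lt h g
  have h3 : singularValueFunction s (g : Matrix (Fin d) (Fin d) ℝ) =
      singularProd ⌊s⌋₊ (g : Matrix (Fin d) (Fin d) ℝ) *
      (Matrix.toEuclideanLin (g : Matrix (Fin d) (Fin d) ℝ)).singularValues ⌊s⌋₊ ^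
        (s - (⌊s⌋₊ : ℝ)) := rfl
  have h4 : singularProd (⌊s⌋₊ + 1) (g : Matrix (Fin d) (Fin d) ℝ) =
      singularProd ⌊s⌋₊ (g : Matrix (Fin d) (Fin d) ℝ) *
      (Matrix.toEuclideanLin (g : Matrix (Fin d) (Fin d) ℝ)).singularValues ⌊s⌋₊ :=
    Finset.prod_range_succ _ _
  rw [h3, h4, Real.log_mul h1.ne' (Real.rpow_pos_of_pos h2 _).ne', Real.log_mul h1.ne' h2.ne',
    Real.log_rpow h2]
  ring

theorem log_singularProd_mul_le {d k : ℕ} (hk : k ≤ d) (g h : GL (Fin d) ℝ) :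
    Real.log (singularProd k ((g * h : GL (Fin d) ℝ) : Matrix (Fin d) (Fin d) ℝ)) ≤
      Real.log (singularProd k (g : Matrix (Fin d) (Fin d) ℝ)) +
      Real.log (singularProd k (h : Matrix (Fin d) (Fin d) ℝ)) := by
  rw [← Real.log_mul (singularProd_pos hk g).ne' (singularProd_pos hk h).ne']
  exact Real.log_le_log (singularProd_pos hk _) (singularProd_mul_le hk _ _)

/-- The singular value function is submultiplicative. -/
theorem log_singularValueFunction_mul_le {d : ℕ} {s : ℝ} (h0 : 0 ≤ s) (hs : s ≤ d)
    (g h : GL (Fin d) ℝ) :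
    Real.log (singularValueFunction s ((g * h : GL (Fin d) ℝ) : Matrix (Fin d) (Fin d) ℝ)) ≤
      Real.log (singularValueFunction s (g : Matrix (Fin d) (Fin d) ℝ)) +
      Real.log (singularValueFunction s (h : Matrix (Fin d) (Fin d) ℝ)) := by
  rcases floor_lt_or_eq h0 hs with hd | rfl
  · simp only [log_singularValueFunction_of_floor_lt hd]
    have h1 := log_singularProd_mul_le hd.le g h
    have h2 := log_singularProd_mul_le (Nat.succ_le_of_lt hd) g h
    have h3 : 0 ≤ s - ⌊s⌋₊ := sub_nonneg.2 (Nat.floor_le h0)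
    have h4 : 0 ≤ 1 - (s - ⌊s⌋₊) := by linarith [Nat.lt_floor_add_one s]
    nlinarith [mul_le_mul_of_nonneg_left h1 h4, mul_le_mul_of_nonneg_left h2 h3]
  · simp only [singularValueFunction_natCast]
    exact log_singularProd_mul_le le_rfl g h

theorem log_singularProd {d k : ℕ} (hk : k ≤ d) (g : GL (Fin d) ℝ) :
    Real.log (singularProd k (g : Matrix (Fin d) (Fin d) ℝ)) = ∑ i ∈ Finset.range k,
      Real.log ((Matrix.toEuclideanLin (g : Matrix (Fin d) (Fin d) ℝ)).singularValues i) :=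
  Real.log_prod fun _ hi =>
    (singularValues_pos_of_lt ((Finset.mem_range.1 hi).trans_le hk) g).ne'

/-- Clamping `s - i` to `[0, 1]` gives weight one below the floor, the fractional part at the floor
and zero above. These weights are 1-Lipschitz in `s`, also across integers. -/
theorem sum_clamp_mul {d : ℕ} {s : ℝ} (h0 : 0 ≤ s) (hd : ⌊s⌋₊ < d) (x : ℕ → ℝ) :
    ∑ i ∈ Finset.range d, max 0 (min 1 (s - i)) * x i =
      ∑ i ∈ Finset.range ⌊s⌋₊, x i + (s - ⌊s⌋₊) * x ⌊s⌋₊ := by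
  rw [← Finset.sum_range_add_sum_Ico _ (Nat.succ_le_of_lt hd), Finset.sum_range_succ]
  have h1 : ∑ i ∈ Finset.range ⌊s⌋₊, max 0 (min 1 (s - i)) * x i =
      ∑ i ∈ Finset.range ⌊s⌋₊, x i := by
    refine Finset.sum_congr rfl fun i hi => ?_
    have : (i : ℝ) + 1 ≤ s := by
      have := Nat.succ_le_of_lt (Finset.mem_range.1 hi)
      exact_mod_cast (Nat.le_floor_iff h0).1 this
    rw [min_eq_left (by linarith), max_eq_right zero_le_one, one_mul]
  have h2 : ∑ i ∈ Finset.Ico (⌊s⌋₊ + 1) d, max 0 (min 1 (s - i)) * x i = 0 := by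
    refine Finset.sum_eq_zero fun i hi => ?_
    have : s ≤ i := (Nat.lt_of_floor_lt (Nat.lt_of_succ_le (Finset.mem_Ico.1 hi).1)).le
    rw [min_eq_right (by linarith), max_eq_left (by linarith), zero_mul]
  have h3 : max 0 (min 1 (s - ⌊s⌋₊)) = s - ⌊s⌋₊ := by
    rw [min_eq_right (by linarith [Nat.lt_floor_add_one s]),
      max_eq_right (sub_nonneg.2 (Nat.floor_le h0))]
  rw [Nat.succ_eq_add_one, h1, h2, h3, add_zero]

theorem log_singularValueFunction {d : ℕ} {s : ℝ} (h0 : 0 ≤ s) (hs : s ≤ d) (g : GL (Fin d) ℝ) :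
    Real.log (singularValueFunction s (g : Matrix (Fin d) (Fin d) ℝ)) =
      ∑ i ∈ Finset.range d, max 0 (min 1 (s - i)) *
        Real.log ((Matrix.toEuclideanLin (g : Matrix (Fin d) (Fin d) ℝ)).singularValues i) := by
  rcases floor_lt_or_eq h0 hs with hd | rfl
  · rw [sum_clamp_mul h0 hd, log_singularValueFunction_of_floor_lt hd, log_singularProd hd.le,
      log_singularProd (Nat.succ_le_of_lt hd), Nat.succ_eq_add_one, Finset.sum_range_succ]
    ring
  · rw [singularValueFunction_natCast, log_singularProd le_rfl]
    refine Finset.sum_congr rfl fun i hi => ?_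
    have : (i : ℝ) + 1 ≤ d := by exact_mod_cast Finset.mem_range.1 hi
    rw [min_eq_left (by linarith), max_eq_right zero_le_one, one_mul]

theorem abs_clamp_sub_clamp_le (a b : ℝ) :
    |max 0 (min 1 a) - max 0 (min 1 b)| ≤ |a - b| := by
  refine (abs_max_sub_max_le_max 0 (min 1 a) 0 (min 1 b)).trans ?_
  simpa using abs_min_sub_min_le_max 1 a 1 b

/-! ### Bounds along words -/

/-- The product along a word as an element of the general linear group. -/
def wordUnit {d N : ℕ} (A : Fin N → GL (Fin d) ℝ) {n : ℕ} (w : Fin n → Fin N) : GL (Fin d) ℝ :=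
  (List.ofFn fun k => A (w k)).prod

theorem coe_wordUnit {d N : ℕ} (A : Fin N → GL (Fin d) ℝ) {n : ℕ} (w : Fin n → Fin N) :
    (wordUnit A w : Matrix (Fin d) (Fin d) ℝ) = wordProd A w := by
  rw [wordUnit, wordProd, ← Units.coeHom_apply, map_list_prod, List.map_ofFn]
  rfl

theorem wordUnit_append {d N : ℕ} (A : Fin N → GL (Fin d) ℝ) {m n : ℕ} (u : Fin m → Fin N)
    (v : Fin n → Fin N) : wordUnit A (Fin.append u v) = wordUnit A u * wordUnit A v := by
  rw [wordUnit, wordUnit, wordUnit, ← List.prod_append, ← List.ofFn_fin_append]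
  congr 2
  ext k : 1
  refine Fin.addCases (fun i => ?_) (fun i => ?_) k <;> simp

theorem exists_abs_log_singularProd_wordUnit_le {d N : ℕ} (A : Fin N → GL (Fin d) ℝ) :
    ∃ L : ℝ, 0 ≤ L ∧ ∀ k ≤ d, ∀ n (w : Fin n → Fin N),
      |Real.log (singularProd k (wordUnit A w : Matrix (Fin d) (Fin d) ℝ))| ≤ L * n := by
  let S : Finset ℝ := (Finset.univ : Finset (Fin N × Fin (d + 1))).image fun p =>
    |Real.log (singularProd (p.2 : ℕ) (A p.1 : Matrix (Fin d) (Fin d) ℝ))| +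
    |Real.log (singularProd (p.2 : ℕ) (((A p.1)⁻¹ : GL (Fin d) ℝ) : Matrix (Fin d) (Fin d) ℝ))|
  obtain ⟨L₀, hL₀⟩ := S.bddAbove
  have hL : ∀ k ≤ d, ∀ i : Fin N,
      |Real.log (singularProd k (A i : Matrix (Fin d) (Fin d) ℝ))| ≤ max L₀ 0 ∧
      |Real.log (singularProd k (((A i)⁻¹ : GL (Fin d) ℝ) : Matrix (Fin d) (Fin d) ℝ))|
        ≤ max L₀ 0 := by
    intro k hk i
    have h := hL₀ (Finset.mem_coe.2 (Finset.mem_image_of_mem _ (Finset.mem_univ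
      ((i, ⟨k, Nat.lt_succ_of_le hk⟩) : Fin N × Fin (d + 1)))))
    have h1 := le_max_left L₀ 0
    simp only at h
    constructor
    · linarith [abs_nonneg (Real.log (singularProd k
        (((A i)⁻¹ : GL (Fin d) ℝ) : Matrix (Fin d) (Fin d) ℝ)))]
    · linarith [abs_nonneg (Real.log (singularProd k (A i : Matrix (Fin d) (Fin d) ℝ)))]
  refine ⟨max L₀ 0, le_max_right _ _, fun k hk n w => ?_⟩
  -- Submultiplicativity only bounds from above; the lower bound for the word comes from the upper
  -- bound for its inverse.
  have key : ∀ l : List (Fin N),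
      Real.log (singularProd k ((l.map A).prod : Matrix (Fin d) (Fin d) ℝ)) ≤
        max L₀ 0 * l.length ∧
      Real.log (singularProd k (((l.map A).prod⁻¹ : GL (Fin d) ℝ) : Matrix (Fin d) (Fin d) ℝ)) ≤
        max L₀ 0 * l.length := by
    intro l
    induction l with
    | nil => simp [singularProd_one hk]
    | cons a l ih =>
      simp only [List.map_cons, List.prod_cons, mul_inv_rev, List.length_cons, Nat.cast_add,
        Nat.cast_one]
      have h1 := log_singularProd_mul_le hk (A a) (l.map A).prod
      have h2 := log_singularProd_mul_le hk (l.map A).prod⁻¹ (A a)⁻¹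
      have h3 := (le_abs_self _).trans (hL k hk a).1
      have h4 := (le_abs_self _).trans (hL k hk a).2
      constructor <;> nlinarith [ih.1, ih.2]
  have hw : wordUnit A w = ((List.ofFn w).map A).prod := by
    rw [wordUnit, List.map_ofFn]; rfl
  have h := key (List.ofFn w)
  rw [← hw, List.length_ofFn] at h
  have h1 := log_singularProd_mul_le hk (wordUnit A w) (wordUnit A w)⁻¹
  rw [mul_inv_cancel, Units.val_one, singularProd_one hk, Real.log_one] at h1
  exact abs_le.2 ⟨by linarith [h.2], h.1⟩

theorem exists_abs_log_singularValues_le {d N : ℕ} (A : Fin N → GL (Fin d) ℝ) :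
    ∃ L : ℝ, 0 ≤ L ∧ ∀ i < d, ∀ n (w : Fin n → Fin N),
      |Real.log ((Matrix.toEuclideanLin
        (wordUnit A w : Matrix (Fin d) (Fin d) ℝ)).singularValues i)| ≤ L * n := by
  obtain ⟨L, hL, h⟩ := exists_abs_log_singularProd_wordUnit_le A
  refine ⟨2 * L, by positivity, fun i hi n w => ?_⟩
  have h1 := h i hi.le n w
  have h2 := h (i + 1) hi n w
  rw [log_singularProd (Nat.succ_le_of_lt hi), Nat.succ_eq_add_one, Finset.sum_range_succ,
    ← log_singularProd hi.le] at h2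
  rw [abs_le] at *
  constructor <;> linarith [h1.1, h1.2, h2.1, h2.2]

/-- Along words, the logarithm of the singular value function is Lipschitz in the exponent. -/
theorem exists_abs_log_singularValueFunction_sub_le {d N : ℕ} (A : Fin N → GL (Fin d) ℝ) :
    ∃ C : ℝ, 0 ≤ C ∧ ∀ s t : ℝ, 0 ≤ s → s ≤ d → 0 ≤ t → t ≤ d → ∀ n (w : Fin n → Fin N),
      |Real.log (singularValueFunction s (wordProd A w)) -
        Real.log (singularValueFunction t (wordProd A w))| ≤ C * |s - t| * n := by
  obtain ⟨L, hL, h⟩ := exists_abs_log_singularValues_le A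
  refine ⟨d * L, by positivity, fun s t hs hs' ht ht' n w => ?_⟩
  rw [← coe_wordUnit, log_singularValueFunction hs hs', log_singularValueFunction ht ht',
    ← Finset.sum_sub_distrib]
  refine (Finset.abs_sum_le_sum_abs _ _).trans ?_
  have : ∀ i ∈ Finset.range d, |max 0 (min 1 (s - i)) *
        Real.log ((Matrix.toEuclideanLin
          (wordUnit A w : Matrix (Fin d) (Fin d) ℝ)).singularValues i) -
      max 0 (min 1 (t - i)) * Real.log ((Matrix.toEuclideanLin
          (wordUnit A w : Matrix (Fin d) (Fin d) ℝ)).singularValues i)| ≤ |s - t| * (L * n) := by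
    intro i hi
    rw [← sub_mul, abs_mul]
    refine mul_le_mul ?_ (h i (Finset.mem_range.1 hi) n w) (abs_nonneg _) (abs_nonneg _)
    simpa using abs_clamp_sub_clamp_le (s - i) (t - i)
  refine (Finset.sum_le_sum this).trans (le_of_eq ?_)
  simp
  ring

theorem exists_abs_log_singularValueFunction_le {d N : ℕ} (A : Fin N → GL (Fin d) ℝ) {s : ℝ}
    (h0 : 0 ≤ s) (hs : s ≤ d) : ∃ C : ℝ, 0 ≤ C ∧ ∀ n (w : Fin n → Fin N),
      |Real.log (singularValueFunction s (wordProd A w))| ≤ C * n := by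
  obtain ⟨C, hC, h⟩ := exists_abs_log_singularValueFunction_sub_le A
  refine ⟨C * |s|, by positivity, fun n w => ?_⟩
  have := h s 0 h0 hs le_rfl (by positivity) n w
  have h1 : singularValueFunction 0 (wordProd A w) = 1 := by simp [singularValueFunction]
  simpa [h1] using this

/-! ### Entropy inequalities for finite probability vectors -/

-- This is `log x ≤ x - 1` at `x = b / a`. Between probability vectors the error terms `b - a` sum
-- to zero.
open Real in
theorem negMulLog_le_neg_mul_log_add_sub {a b : ℝ} (ha : 0 ≤ a) (hb : 0 ≤ b) (h : b = 0 → a = 0) :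
    negMulLog a ≤ -(a * log b) + (b - a) := by
  rcases ha.eq_or_lt with rfl | ha
  · simpa using hb
  · have hb' : 0 < b := hb.lt_of_ne fun h0 => ha.ne' (h h0.symm)
    have h1 := log_le_sub_one_of_pos (div_pos hb' ha)
    rw [log_div hb'.ne' ha.ne'] at h1
    have h2 := mul_le_mul_of_nonneg_left h1 ha.le
    rw [mul_sub, mul_sub, mul_div_cancel₀ _ ha.ne'] at h2
    rw [negMulLog]
    linarith

open Real in
/-- Subadditivity of Shannon entropy. -/
theorem sum_negMulLog_le {β γ : Type*} [Fintype β] [Fintype γ] {r : β → γ → ℝ}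
    (hr : ∀ b c, 0 ≤ r b c) (h1 : ∑ b, ∑ c, r b c = 1) :
    ∑ b, ∑ c, negMulLog (r b c) ≤
      ∑ b, negMulLog (∑ c, r b c) + ∑ c, negMulLog (∑ b, r b c) := by
  -- Compare the joint law with the product of its marginals.
  have key : ∀ b c, negMulLog (r b c) ≤
      -(r b c * log (∑ c, r b c)) + -(r b c * log (∑ b, r b c)) +
        ((∑ c, r b c) * (∑ b, r b c) - r b c) := by
    intro b c
    rcases (hr b c).eq_or_lt with h | h
    · rw [← h]
      simpa using mul_nonneg (Finset.sum_nonneg fun c _ => hr b c)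
        (Finset.sum_nonneg fun b _ => hr b c)
    · have hb : 0 < ∑ c, r b c :=
        h.trans_le (Finset.single_le_sum (f := fun c => r b c) (fun c _ => hr b c)
          (Finset.mem_univ c))
      have hc : 0 < ∑ b, r b c :=
        h.trans_le (Finset.single_le_sum (f := fun b => r b c) (fun b _ => hr b c)
          (Finset.mem_univ b))
      have := negMulLog_le_neg_mul_log_add_sub h.le (mul_pos hb hc).le
        (fun h0 => absurd h0 (mul_pos hb hc).ne')
      rw [log_mul hb.ne' hc.ne'] at this
      linarith
  have h2 : ∑ c, ∑ b, r b c = 1 := by rw [Finset.sum_comm, h1]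
  have h3 : ∑ b, ∑ c, -(r b c * log (∑ c, r b c)) = ∑ b, negMulLog (∑ c, r b c) := by
    refine Finset.sum_congr rfl fun b _ => ?_
    rw [Finset.sum_neg_distrib, ← Finset.sum_mul, negMulLog, neg_mul]
  have h4 : ∑ b, ∑ c, -(r b c * log (∑ b, r b c)) = ∑ c, negMulLog (∑ b, r b c) := by
    rw [Finset.sum_comm]
    refine Finset.sum_congr rfl fun b _ => ?_
    rw [Finset.sum_neg_distrib, ← Finset.sum_mul, negMulLog, neg_mul]
  have h5 : ∑ b, ∑ c, ((∑ c, r b c) * (∑ b, r b c) - r b c) = 0 := by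
    simp only [Finset.sum_sub_distrib, ← Finset.mul_sum, ← Finset.sum_mul, h1, h2]
    norm_num
  calc _ ≤ ∑ b, ∑ c, (-(r b c * log (∑ c, r b c)) + -(r b c * log (∑ b, r b c)) +
        ((∑ c, r b c) * (∑ b, r b c) - r b c)) :=
        Finset.sum_le_sum fun b _ => Finset.sum_le_sum fun c _ => key b c
    _ = _ := by
        simp only [Finset.sum_add_distrib]
        rw [h3, h4, h5, add_zero]

open Real in
/-- The Gibbs inequality. -/
theorem sum_negMulLog_add_le_log_sum_exp {β : Type*} [Fintype β] [Nonempty β] {p : β → ℝ}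
    (hp : ∀ b, 0 ≤ p b) (h1 : ∑ b, p b = 1) (f : β → ℝ) :
    ∑ b, negMulLog (p b) + ∑ b, p b * f b ≤ log (∑ b, exp (f b)) := by
  have hZ : 0 < ∑ b, exp (f b) :=
    Finset.sum_pos (fun b _ => exp_pos _) Finset.univ_nonempty
  have key : ∀ b, negMulLog (p b) + p b * f b ≤
      p b * log (∑ b, exp (f b)) + (exp (f b) / ∑ b, exp (f b)) - p b := by
    intro b
    have hq := div_pos (exp_pos (f b)) hZ
    have := negMulLog_le_neg_mul_log_add_sub (hp b) hq.le (fun h0 => absurd h0 hq.ne')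
    rw [log_div (exp_pos _).ne' hZ.ne', log_exp] at this
    linarith
  rw [← Finset.sum_add_distrib]
  refine (Finset.sum_le_sum fun b _ => key b).trans (le_of_eq ?_)
  rw [Finset.sum_sub_distrib, Finset.sum_add_distrib, ← Finset.sum_mul, ← Finset.sum_div, h1,
    div_self hZ.ne']
  ring

open Real in
theorem sum_negMulLog_gibbs {β : Type*} [Fintype β] [Nonempty β] (f : β → ℝ) {p : β → ℝ}
    (hp : ∀ b, p b = exp (f b) / ∑ b, exp (f b)) :
    ∑ b, negMulLog (p b) + ∑ b, p b * f b = log (∑ b, exp (f b)) := by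
  have hZ : 0 < ∑ b, exp (f b) :=
    Finset.sum_pos (fun b _ => exp_pos _) Finset.univ_nonempty
  have h1 : ∑ b, p b = 1 := by
    simp only [hp]
    rw [← Finset.sum_div, div_self hZ.ne']
  rw [← Finset.sum_add_distrib]
  calc _ = ∑ b, p b * log (∑ b, exp (f b)) := by
        refine Finset.sum_congr rfl fun b _ => ?_
        have : log (p b) = f b - log (∑ b, exp (f b)) := by
          rw [hp, log_div (exp_pos _).ne' hZ.ne', log_exp]
        rw [negMulLog, this]
        ring
    _ = _ := by rw [← Finset.sum_mul, h1, one_mul]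

/-! ### Marginals of measures on infinite words -/

theorem sum_append {α : Type*} [Fintype α] {m n : ℕ} (g : (Fin (m + n) → α) → ℝ) :
    ∑ w, g w = ∑ u : Fin m → α, ∑ v : Fin n → α, g (Fin.append u v) := by
  rw [← (Fin.appendEquiv m n).sum_comp, Fintype.sum_prod_type]
  rfl

/-- The set of infinite words that show the word `w` at position `i`. -/
def window {M n : ℕ} (i : ℕ) (w : Fin n → Fin M) : Set (ℕ → Fin M) :=
  {x | ∀ k : Fin n, x (i + k) = w k}

theorem window_zero {M n : ℕ} (w : Fin n → Fin M) : window 0 w = cylinder w := by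
  simp [window, cylinder]

theorem isClopen_window {M n : ℕ} (i : ℕ) (w : Fin n → Fin M) : IsClopen (window i w) := by
  have : window i w = ⋂ k : Fin n, (fun x : ℕ → Fin M => x (i + k)) ⁻¹' {w k} := by
    ext x; simp [window]
  rw [this]
  exact isClopen_iInter_of_finite fun k => (isClopen_discrete _).preimage (continuous_apply _)

theorem measurableSet_window {M n : ℕ} (i : ℕ) (w : Fin n → Fin M) :
    MeasurableSet (window i w) :=
  (isClopen_window i w).isOpen.measurableSet

theorem window_append {M m n : ℕ} (i : ℕ) (u : Fin m → Fin M) (v : Fin n → Fin M) :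
    window i (Fin.append u v) = window i u ∩ window (i + m) v := by
  ext x
  simp only [window, Set.mem_ofPred_eq, Set.mem_inter_iff, Fin.forall_fin_add, Fin.append_left,
    Fin.append_right, Fin.val_castAdd, Fin.val_natAdd, add_assoc]

theorem iUnion_window (M n i : ℕ) : ⋃ w : Fin n → Fin M, window i w = Set.univ := by
  refine Set.eq_univ_of_forall fun x => Set.mem_iUnion.2 ⟨fun k => x (i + k), fun k => rfl⟩

theorem pairwise_disjoint_window (M n i : ℕ) :
    Pairwise (Function.onFun Disjoint fun w : Fin n → Fin M => window i w) := by
  intro u v huv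
  refine Set.disjoint_left.2 fun x hu hv => huv ?_
  ext k : 1
  rw [← hu k, ← hv k]

theorem sum_measureReal_inter_window {M : ℕ} (ν : Measure (ℕ → Fin M)) [IsFiniteMeasure ν]
    (i n : ℕ) {S : Set (ℕ → Fin M)} (hS : MeasurableSet S) :
    ∑ w : Fin n → Fin M, ν.real (S ∩ window i w) = ν.real S := by
  rw [← measureReal_iUnion_fintype, ← Set.inter_iUnion, iUnion_window, Set.inter_univ]
  · intro u v huv
    exact (pairwise_disjoint_window M n i huv).mono Set.inter_subset_right Set.inter_subset_right
  · exact fun w => hS.inter (measurableSet_window i w)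

/-- The Shannon entropy of the letters at the positions `i, …, i + n - 1`. -/
def windowEntropy {M : ℕ} (ν : Measure (ℕ → Fin M)) (i n : ℕ) : ℝ :=
  ∑ w : Fin n → Fin M, Real.negMulLog (ν.real (window i w))

/-- The expectation of the potential `F` on the letters at the positions `i, …, i + n - 1`. -/
def windowEnergy {M : ℕ} (F : ∀ n, (Fin n → Fin M) → ℝ) (ν : Measure (ℕ → Fin M)) (i n : ℕ) : ℝ :=
  ∑ w : Fin n → Fin M, ν.real (window i w) * F n w

section

variable {M : ℕ} (ν : Measure (ℕ → Fin M)) [IsProbabilityMeasure ν]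

theorem sum_measureReal_window (i n : ℕ) : ∑ w : Fin n → Fin M, ν.real (window i w) = 1 := by
  simpa using sum_measureReal_inter_window ν i n MeasurableSet.univ

theorem sum_measureReal_window_append_right (i n : ℕ) {m : ℕ} (u : Fin m → Fin M) :
    ∑ v : Fin n → Fin M, ν.real (window i (Fin.append u v)) = ν.real (window i u) := by
  simp only [window_append]
  exact sum_measureReal_inter_window ν _ n (measurableSet_window i u)

theorem sum_measureReal_window_append_left (i m : ℕ) {n : ℕ} (v : Fin n → Fin M) :
    ∑ u : Fin m → Fin M, ν.real (window i (Fin.append u v)) = ν.real (window (i + m) v) := by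
  simp only [window_append, Set.inter_comm (window i _)]
  exact sum_measureReal_inter_window ν _ m (measurableSet_window _ v)

theorem windowEntropy_nonneg (i n : ℕ) : 0 ≤ windowEntropy ν i n :=
  Finset.sum_nonneg fun _ _ => Real.negMulLog_nonneg measureReal_nonneg measureReal_le_one

/-- The two halves of the window are the marginals of its law. The position `i` is kept because `ν`
need not be invariant. -/
theorem windowEntropy_add_le (i m n : ℕ) :
    windowEntropy ν i (m + n) ≤ windowEntropy ν i m + windowEntropy ν (i + m) n := by
  have h := sum_negMulLog_le
    (r := fun (u : Fin m → Fin M) (v : Fin n → Fin M) => ν.real (window i (Fin.append u v)))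
    (fun _ _ => measureReal_nonneg)
    (by rw [← sum_append fun w => ν.real (window i w), sum_measureReal_window])
  simp only [sum_measureReal_window_append_right, sum_measureReal_window_append_left] at h
  rwa [windowEntropy, sum_append]

theorem windowEnergy_add_le {F : ∀ n, (Fin n → Fin M) → ℝ}
    (hF : ∀ m n u v, F (m + n) (Fin.append u v) ≤ F m u + F n v) (i m n : ℕ) :
    windowEnergy F ν i (m + n) ≤ windowEnergy F ν i m + windowEnergy F ν (i + m) n := by
  rw [windowEnergy, sum_append]
  calc _ ≤ ∑ u : Fin m → Fin M, ∑ v : Fin n → Fin M,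
        (ν.real (window i (Fin.append u v)) * F m u +
          ν.real (window i (Fin.append u v)) * F n v) := by
        refine Finset.sum_le_sum fun u _ => Finset.sum_le_sum fun v _ => ?_
        rw [← mul_add]
        exact mul_le_mul_of_nonneg_left (hF m n u v) measureReal_nonneg
    _ = _ := by
        simp only [Finset.sum_add_distrib]
        congr 1
        · simp only [← Finset.sum_mul, sum_measureReal_window_append_right]
          rfl
        · rw [Finset.sum_comm]
          simp only [← Finset.sum_mul, sum_measureReal_window_append_left]
          rfl

theorem abs_windowEnergy_le {F : ∀ n, (Fin n → Fin M) → ℝ} {C : ℝ}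
    (hC : ∀ n w, |F n w| ≤ C * n) (i n : ℕ) : |windowEnergy F ν i n| ≤ C * n := by
  calc |windowEnergy F ν i n| ≤ ∑ w : Fin n → Fin M, ν.real (window i w) * (C * n) := by
        refine (Finset.abs_sum_le_sum_abs _ _).trans (Finset.sum_le_sum fun w _ => ?_)
        rw [abs_mul, abs_of_nonneg measureReal_nonneg]
        exact mul_le_mul_of_nonneg_left (hC n w) measureReal_nonneg
    _ = C * n := by rw [← Finset.sum_mul, sum_measureReal_window, one_mul]

end

/-! ### Partition sums -/

/-- The logarithm of the partition sum over words of length `n`. -/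
def logPartition {M : ℕ} (F : ∀ n, (Fin n → Fin M) → ℝ) (n : ℕ) : ℝ :=
  Real.log (∑ w, Real.exp (F n w))

section

variable {M : ℕ} [NeZero M] {F : ∀ n, (Fin n → Fin M) → ℝ}

theorem sum_exp_pos (n : ℕ) : 0 < ∑ w, Real.exp (F n w) :=
  Finset.sum_pos (fun _ _ => Real.exp_pos _) Finset.univ_nonempty

theorem logPartition_add_le
    (hF : ∀ m n u v, F (m + n) (Fin.append u v) ≤ F m u + F n v) (m n : ℕ) :
    logPartition F (m + n) ≤ logPartition F m + logPartition F n := by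
  rw [logPartition, logPartition, logPartition,
    ← Real.log_mul (sum_exp_pos m).ne' (sum_exp_pos n).ne']
  refine Real.log_le_log (sum_exp_pos _) ?_
  rw [sum_append, Finset.sum_mul_sum]
  refine Finset.sum_le_sum fun u _ => Finset.sum_le_sum fun v _ => ?_
  rw [← Real.exp_add]
  exact Real.exp_le_exp.2 (hF m n u v)

theorem neg_mul_le_logPartition {C : ℝ} (hC : ∀ n w, |F n w| ≤ C * n) (n : ℕ) :
    -(C * n) ≤ logPartition F n := by
  rw [logPartition, Real.le_log_iff_exp_le (sum_exp_pos n)]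
  refine le_trans ?_ (Finset.single_le_sum (f := fun w => Real.exp (F n w))
    (fun w _ => (Real.exp_pos _).le) (Finset.mem_univ 0))
  exact Real.exp_le_exp.2 (abs_le.1 (hC n 0)).1

theorem logPartition_le {C : ℝ} (hC : ∀ n w, |F n w| ≤ C * n) (n : ℕ) :
    logPartition F n ≤ (Real.log M + C) * n := by
  have hM : (0 : ℝ) < M := by exact_mod_cast NeZero.pos M
  rw [logPartition, Real.log_le_iff_le_exp (sum_exp_pos n)]
  calc ∑ w, Real.exp (F n w) ≤ ∑ w : Fin n → Fin M, Real.exp (C * n) :=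
        Finset.sum_le_sum fun w _ => Real.exp_le_exp.2 (abs_le.1 (hC n w)).2
    _ = Real.exp ((Real.log M + C) * n) := by
        rw [add_mul, Real.exp_add, mul_comm (Real.log M), Real.exp_nat_mul, Real.exp_log hM]
        simp

theorem exists_tendsto_logPartition {C : ℝ}
    (hF : ∀ m n u v, F (m + n) (Fin.append u v) ≤ F m u + F n v)
    (hC : ∀ n w, |F n w| ≤ C * n) :
    ∃ P, Tendsto (fun n : ℕ => logPartition F n / n) atTop (nhds P) := by
  have h : Subadditive (logPartition F) := logPartition_add_le hF
  have hC0 : 0 ≤ C := by simpa using (abs_nonneg _).trans (hC 1 0)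
  refine ⟨_, h.tendsto_lim ⟨-C, ?_⟩⟩
  rintro _ ⟨n, rfl⟩
  rcases n.eq_zero_or_pos with rfl | hn
  · simpa using hC0
  · have : (0 : ℝ) < n := by exact_mod_cast hn
    rw [le_div_iff₀ this]
    linarith [neg_mul_le_logPartition hC n]

theorem windowEntropy_add_windowEnergy_le (ν : Measure (ℕ → Fin M)) [IsProbabilityMeasure ν]
    (i n : ℕ) : windowEntropy ν i n + windowEnergy F ν i n ≤ logPartition F n :=
  sum_negMulLog_add_le_log_sum_exp (fun _ => measureReal_nonneg) (sum_measureReal_window ν i n) _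

end

/-! ### Construction of equilibrium states -/

/-- Comparison of the initial value with sliding windows of a fixed length `m`. -/
theorem mul_le_sum_add_of_subadditive {G : ℕ → ℕ → ℝ} {K C : ℝ} (hK : 0 ≤ K)
    (hG : ∀ i m n, G i (m + n) ≤ G i m + G (i + m) n) (hGK : ∀ i n, G i n ≤ K * n)
    (hGC : ∀ i n, -(C * n) ≤ G i n) {m n : ℕ} (hmn : m ≤ n) :
    m * G 0 n ≤ ∑ i ∈ Finset.range n, G i m + m * m * (2 * K + C) := by
  obtain ⟨n, rfl⟩ := Nat.exists_eq_add_of_le' hmn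
  -- Passing from `n` to `n + 1` replaces `G 0 n` by `G 0 (n + m)`, which costs at most one window
  -- `G n m`.
  have h1 : ∀ n, ∑ k ∈ Finset.range m, G 0 (n + k) ≤
      ∑ k ∈ Finset.range m, G 0 k + ∑ i ∈ Finset.range n, G i m := by
    intro n
    induction n with
    | zero => simp
    | succ n ih =>
      have h2 := Finset.sum_range_succ (fun k => G 0 (n + k)) m
      rw [Finset.sum_range_succ' (fun k => G 0 (n + k)) m] at h2
      have h3 := hG 0 n m
      simp only [add_zero, zero_add] at h2 h3
      have h4 : ∑ k ∈ Finset.range m, G 0 (n + 1 + k) =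
          ∑ k ∈ Finset.range m, G 0 (n + (k + 1)) :=
        Finset.sum_congr rfl fun k _ => by rw [add_assoc, add_comm 1 k]
      rw [Finset.sum_range_succ]
      linarith
  have h2 : ∑ k ∈ Finset.range m, G 0 k ≤ m * (K * m) := by
    refine (Finset.sum_le_card_nsmul _ _ (K * m) fun k hk => ?_).trans (by simp)
    refine (hGK 0 k).trans (mul_le_mul_of_nonneg_left ?_ hK)
    exact_mod_cast (Finset.mem_range.1 hk).le
  have h3 : m * (G 0 (n + m) - K * m) ≤ ∑ k ∈ Finset.range m, G 0 (n + k) := by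
    have := Finset.card_nsmul_le_sum (Finset.range m) (fun k => G 0 (n + k))
      (G 0 (n + m) - K * m) fun k hk => ?_
    · simpa using this
    · have hk' := (Finset.mem_range.1 hk).le
      have h4 := hG 0 (n + k) (m - k)
      rw [add_assoc, Nat.add_sub_cancel' hk'] at h4
      have h5 : G (0 + (n + k)) (m - k) ≤ K * m :=
        (hGK _ _).trans (mul_le_mul_of_nonneg_left (by exact_mod_cast Nat.sub_le m k) hK)
      linarith
  -- Adding the last `m` windows costs `m * m * C`; the initial and final segments in `h2` and `h3`
  -- cost `m * m * K` each.
  have h4 : ∑ i ∈ Finset.range n, G i m - m * (C * m) ≤ ∑ i ∈ Finset.range (n + m), G i m := by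
    rw [Finset.sum_range_add]
    have := Finset.card_nsmul_le_sum (Finset.range m) (fun k => G (n + k) m) (-(C * m))
      fun k _ => hGC _ _
    simp only [Finset.card_range, nsmul_eq_mul] at this
    linarith
  have h4' : ∑ i ∈ Finset.range n, G i m ≤
      ∑ i ∈ Finset.range (n + m), G i m + m * (C * m) := by linarith
  have := h1 n
  nlinarith

theorem measurable_shift (M : ℕ) : Measurable (shift (N := M)) :=
  measurable_pi_lambda _ fun n => measurable_pi_apply (n + 1)

theorem iterate_shift_preimage_window {M n : ℕ} (j i : ℕ) (w : Fin n → Fin M) :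
    shift^[j] ⁻¹' window i w = window (i + j) w := by
  have h : ∀ (x : ℕ → Fin M) a, shift^[j] x a = x (a + j) := by
    induction j with
    | zero => simp
    | succ j ih => intro x a; rw [Function.iterate_succ_apply, ih]; simp [shift, add_assoc]
  ext x
  simp only [window, Set.mem_preimage, Set.mem_ofPred_eq, h]
  simp only [add_right_comm]

/-- Every probability vector on words of length `n` is the marginal of a measure. -/
theorem exists_measure_window_zero_eq {M : ℕ} [NeZero M] {n : ℕ} {p : (Fin n → Fin M) → ℝ}
    (hp : ∀ w, 0 ≤ p w) (h1 : ∑ w, p w = 1) :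
    ∃ ν : Measure (ℕ → Fin M), IsProbabilityMeasure ν ∧ ∀ w, ν.real (window 0 w) = p w := by
  let q : PMF (Fin n → Fin M) := PMF.ofFintype (fun w => ENNReal.ofReal (p w)) (by
    rw [← ENNReal.ofReal_sum_of_nonneg fun w _ => hp w, h1, ENNReal.ofReal_one])
  let e : (Fin n → Fin M) → ℕ → Fin M := fun w k => if h : k < n then w ⟨k, h⟩ else 0
  have he : Measurable e := Measurable.of_discrete
  refine ⟨q.toMeasure.map e, Measure.isProbabilityMeasure_map he.aemeasurable, fun w => ?_⟩
  have h2 : e ⁻¹' window 0 w = {w} := by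
    ext v
    simp only [Set.mem_preimage, window, Set.mem_ofPred_eq, Set.mem_singleton_iff, funext_iff, e]
    simp
  rw [map_measureReal_apply he (measurableSet_window _ _), h2, Measure.real,
    PMF.toMeasure_apply_singleton _ _ (MeasurableSet.singleton w), PMF.ofFintype_apply,
    ENNReal.toReal_ofReal (hp w)]

/-- The average of a measure along the first `n` iterates of the shift. -/
theorem exists_measure_average {M : ℕ} (ν : Measure (ℕ → Fin M)) [IsProbabilityMeasure ν] {n : ℕ}
    (hn : n ≠ 0) : ∃ μ : Measure (ℕ → Fin M), IsProbabilityMeasure μ ∧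
      ∀ (i m : ℕ) (w : Fin m → Fin M),
        μ.real (window i w) = (n : ℝ)⁻¹ * ∑ k ∈ Finset.range n, ν.real (window (i + k) w) := by
  have hs : ∀ k, Measurable (shift (N := M))^[k] := fun k => (measurable_shift M).iterate k
  let μ : Measure (ℕ → Fin M) := (n : ENNReal)⁻¹ • ∑ k ∈ Finset.range n, ν.map shift^[k]
  have hμ : ∀ S, MeasurableSet S →
      μ S = (n : ENNReal)⁻¹ * ∑ k ∈ Finset.range n, ν (shift^[k] ⁻¹' S) := by
    intro S hS
    simp only [μ, Measure.smul_apply, Measure.finsetSum_apply, smul_eq_mul]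
    congr 1
    exact Finset.sum_congr rfl fun k _ => Measure.map_apply (hs k) hS
  refine ⟨μ, ⟨?_⟩, fun i m w => ?_⟩
  · rw [hμ _ MeasurableSet.univ]
    simp only [Set.preimage_univ, measure_univ, Finset.sum_const, Finset.card_range, nsmul_eq_mul,
      mul_one]
    exact ENNReal.inv_mul_cancel (by exact_mod_cast hn) (ENNReal.natCast_ne_top n)
  · rw [Measure.real, hμ _ (measurableSet_window i w), ENNReal.toReal_mul,
      ENNReal.toReal_sum fun k _ => measure_ne_top _ _]
    simp only [iterate_shift_preimage_window]
    simp [Measure.real]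

/-- A probability measure on infinite words is determined by its values on cylinders. -/
theorem measure_eq_of_window {M : ℕ} (μ ν : Measure (ℕ → Fin M)) [IsProbabilityMeasure μ]
    [IsProbabilityMeasure ν]
    (h : ∀ n (w : Fin n → Fin M), μ.real (window 0 w) = ν.real (window 0 w)) : μ = ν := by
  refine ext_of_generate_finite {S | S = ∅ ∨ ∃ n, ∃ w : Fin n → Fin M, S = window 0 w} ?_ ?_ ?_
    (by simp)
  · refine le_antisymm ?_ (MeasurableSpace.generateFrom_le ?_)
    · refine iSup_le fun i => ?_
      rw [MeasurableSpace.comap_le_iff_le_map]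
      intro S _
      rw [MeasurableSpace.map_def]
      have h1 : (fun x : ℕ → Fin M => x i) ⁻¹' S =
          ⋃ w : {w : Fin (i + 1) → Fin M // w (Fin.last i) ∈ S}, window 0 w.1 := by
        ext x
        simp only [Set.mem_preimage, Set.mem_iUnion, window, Set.mem_ofPred_eq, zero_add]
        constructor
        · exact fun hx => ⟨⟨fun k => x k, by simpa using hx⟩, fun k => rfl⟩
        · rintro ⟨⟨w, hw⟩, hx⟩
          have := hx (Fin.last i)
          simp only [Fin.val_last] at this
          rwa [this]
      rw [h1]
      exact MeasurableSet.iUnion fun w =>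
        MeasurableSpace.measurableSet_generateFrom (Or.inr ⟨_, _, rfl⟩)
    · rintro S (rfl | ⟨n, w, rfl⟩)
      · exact MeasurableSet.empty
      · exact measurableSet_window 0 w
  -- Cylinders are nested or disjoint, hence form a π-system together with `∅`.
  · have key : ∀ {m n : ℕ} (u : Fin m → Fin M) (v : Fin n → Fin M), m ≤ n →
        (window 0 u ∩ window 0 v).Nonempty → window 0 u ∩ window 0 v = window 0 v := by
      rintro m n u v hmn ⟨x, hu, hv⟩
      refine Set.inter_eq_right.2 fun y hy k => ?_
      have h1 := hy (Fin.castLE hmn k)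
      have h2 := hv (Fin.castLE hmn k)
      have h3 := hu k
      simp only [Fin.val_castLE] at h1 h2
      rw [h1, ← h2, h3]
    rintro S (rfl | ⟨m, u, rfl⟩) T (rfl | ⟨n, v, rfl⟩) hST
    · simp at hST
    · simp at hST
    · simp at hST
    · right
      rcases le_total m n with hmn | hmn
      · exact ⟨n, v, key u v hmn hST⟩
      · rw [Set.inter_comm] at hST ⊢
        exact ⟨m, u, key v u hmn hST⟩
  · rintro S (rfl | ⟨n, w, rfl⟩)
    · simp
    · have := h n w
      rwa [Measure.real, Measure.real, ENNReal.toReal_eq_toReal_iff' (measure_ne_top _ _)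
        (measure_ne_top _ _)] at this

theorem measurePreserving_shift_of_window {M : ℕ} (μ : Measure (ℕ → Fin M))
    [IsProbabilityMeasure μ]
    (h : ∀ n (w : Fin n → Fin M), μ.real (window 1 w) = μ.real (window 0 w)) :
    MeasurePreserving shift μ μ := by
  refine ⟨measurable_shift M, ?_⟩
  have := Measure.isProbabilityMeasure_map (μ := μ) (measurable_shift M).aemeasurable
  refine measure_eq_of_window _ _ fun n w => ?_
  rw [map_measureReal_apply (measurable_shift M) (measurableSet_window _ _), ← h n w]
  exact congrArg _ (iterate_shift_preimage_window 1 0 w)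

theorem measureReal_window_of_measurePreserving {M : ℕ} {μ : Measure (ℕ → Fin M)}
    (h : MeasurePreserving shift μ μ) (i : ℕ) {n : ℕ} (w : Fin n → Fin M) :
    μ.real (window i w) = μ.real (window 0 w) := by
  have h1 := (h.iterate i).measureReal_preimage (s := window 0 w)
    (measurableSet_window 0 w).nullMeasurableSet
  rwa [iterate_shift_preimage_window, zero_add] at h1

/-- Jensen for the concave `negMulLog`: averaging measures does not lower the average entropy.
Energy is linear in the measure, so it is preserved exactly. -/
theorem average_windowEntropy_le {M : ℕ} {ν μ : Measure (ℕ → Fin M)} {n : ℕ}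
    (hn : n ≠ 0) {m : ℕ} (h : ∀ w : Fin m → Fin M,
      μ.real (window 0 w) = (n : ℝ)⁻¹ * ∑ k ∈ Finset.range n, ν.real (window (0 + k) w)) :
    ∑ k ∈ Finset.range n, windowEntropy ν k m ≤ n * windowEntropy μ 0 m := by
  have hn' : (n : ℝ) ≠ 0 := by exact_mod_cast hn
  have key : ∀ w : Fin m → Fin M,
      ∑ k ∈ Finset.range n, (n : ℝ)⁻¹ * Real.negMulLog (ν.real (window k w)) ≤
        Real.negMulLog (μ.real (window 0 w)) := by
    intro w
    have := Real.concaveOn_negMulLog.le_map_sum (t := Finset.range n) (w := fun _ => (n : ℝ)⁻¹)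
      (p := fun k => ν.real (window k w)) (fun _ _ => by positivity)
      (by simp [hn']) (fun _ _ => measureReal_nonneg)
    simp only [smul_eq_mul, ← Finset.mul_sum] at this
    rw [h w, ← Finset.mul_sum]
    simpa using this
  simp only [windowEntropy]
  rw [Finset.sum_comm, Finset.mul_sum]
  refine Finset.sum_le_sum fun w _ => ?_
  have := mul_le_mul_of_nonneg_left (key w) (Nat.cast_nonneg (α := ℝ) n)
  rwa [← Finset.mul_sum, mul_inv_cancel_left₀ hn'] at this

theorem average_windowEnergy_eq {M : ℕ} (F : ∀ n, (Fin n → Fin M) → ℝ)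
    {ν μ : Measure (ℕ → Fin M)} {n : ℕ}
    (hn : n ≠ 0) {m : ℕ} (h : ∀ w : Fin m → Fin M,
      μ.real (window 0 w) = (n : ℝ)⁻¹ * ∑ k ∈ Finset.range n, ν.real (window (0 + k) w)) :
    ∑ k ∈ Finset.range n, windowEnergy F ν k m = n * windowEnergy F μ 0 m := by
  have hn' : (n : ℝ) ≠ 0 := by exact_mod_cast hn
  simp only [windowEnergy, h, zero_add]
  rw [Finset.sum_comm, Finset.mul_sum]
  refine Finset.sum_congr rfl fun w _ => ?_
  rw [mul_assoc, mul_inv_cancel_left₀ hn', Finset.sum_mul]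

/-- Approximate equilibrium states. -/
theorem exists_approximate_equilibrium {M : ℕ} [NeZero M] {F : ∀ n, (Fin n → Fin M) → ℝ} {C : ℝ}
    (hF : ∀ m n u v, F (m + n) (Fin.append u v) ≤ F m u + F n v)
    (hC : ∀ n w, |F n w| ≤ C * n) {n : ℕ} (hn : n ≠ 0) :
    ∃ μ : Measure (ℕ → Fin M), IsProbabilityMeasure μ ∧
      (∀ (m : ℕ) (w : Fin m → Fin M),
        |μ.real (window 1 w) - μ.real (window 0 w)| ≤ (n : ℝ)⁻¹) ∧
      ∀ m ≤ n, m * logPartition F n ≤ n * (windowEntropy μ 0 m + windowEnergy F μ 0 m) +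
        m * m * (2 * (Real.log M + C) + C) := by
  have hC0 : 0 ≤ C := by simpa using (abs_nonneg _).trans (hC 1 0)
  have hM : 0 ≤ Real.log M := Real.log_natCast_nonneg M
  have hZ := sum_exp_pos (F := F) n
  obtain ⟨ν, hν, hp⟩ := exists_measure_window_zero_eq
    (p := fun w => Real.exp (F n w) / ∑ w, Real.exp (F n w))
    (fun w => by positivity) (by rw [← Finset.sum_div, div_self hZ.ne'])
  obtain ⟨μ, hμ, h⟩ := exists_measure_average ν hn
  refine ⟨μ, hμ, fun m w => ?_, fun m hm => ?_⟩
  -- The difference of the two averages telescopes to two boundary terms divided by `n`.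
  · rw [h, h, ← mul_sub, ← Finset.sum_sub_distrib]
    have h1 := Finset.sum_range_sub (fun k => ν.real (window k w)) n
    simp only [zero_add, add_comm 1]
    rw [h1, abs_mul, abs_of_nonneg (by positivity : (0 : ℝ) ≤ (n : ℝ)⁻¹)]
    refine mul_le_of_le_one_right (by positivity) (abs_le.2 ?_)
    have h2 : ∀ k, 0 ≤ ν.real (window k w) := fun k => measureReal_nonneg
    have h3 : ∀ k, ν.real (window k w) ≤ 1 := fun k => measureReal_le_one
    constructor <;> linarith [h2 0, h2 n, h3 0, h3 n]
  · have h1 : windowEntropy ν 0 n + windowEnergy F ν 0 n = logPartition F n :=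
      sum_negMulLog_gibbs (F n) hp
    have h2 := mul_le_sum_add_of_subadditive
      (G := fun i n => windowEntropy ν i n + windowEnergy F ν i n) (K := Real.log M + C) (C := C)
      (by positivity)
      (fun i m n => by
        linarith [windowEntropy_add_le ν i m n, windowEnergy_add_le ν hF i m n])
      (fun i n => (windowEntropy_add_windowEnergy_le ν i n).trans (logPartition_le hC n))
      (fun i n => by
        linarith [windowEntropy_nonneg ν i n, (abs_le.1 (abs_windowEnergy_le ν hC i n)).1]) hm
    simp only [h1, Finset.sum_add_distrib] at h2
    linarith [average_windowEntropy_le hn (h 0 m), average_windowEnergy_eq F hn (h 0 m)]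

/-- For fixed `m` only finitely many windows matter. They are clopen, so weak convergence passes to
their masses, and entropy and energy converge. The invariance defect and the error term are of order
`1 / n`. -/
theorem exists_invariant_measure_le {M : ℕ} [NeZero M] {F : ∀ n, (Fin n → Fin M) → ℝ} {C P : ℝ}
    (hF : ∀ m n u v, F (m + n) (Fin.append u v) ≤ F m u + F n v)
    (hC : ∀ n w, |F n w| ≤ C * n)
    (hP : Tendsto (fun n : ℕ => logPartition F n / n) atTop (nhds P)) :
    ∃ μ : Measure (ℕ → Fin M), IsProbabilityMeasure μ ∧ MeasurePreserving shift μ μ ∧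
      ∀ m : ℕ, m * P ≤ windowEntropy μ 0 m + windowEnergy F μ 0 m := by
  choose μ hμ hinv hle using fun n : ℕ =>
    exists_approximate_equilibrium hF hC (Nat.succ_ne_zero n)
  let κ : ℕ → ProbabilityMeasure (ℕ → Fin M) := fun n => ⟨μ n, hμ n⟩
  let l : Ultrafilter ℕ := hyperfilter ℕ
  have hl : (l : Filter ℕ) ≤ atTop := Nat.hyperfilter_le_atTop
  -- Compactness gives a limit along a free ultrafilter, so no subsequence has to be chosen.
  obtain ⟨κ', -, hκ'⟩ := isCompact_univ.ultrafilter_le_nhds (l.map κ) (by simp)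
  have hκ : Tendsto κ l (nhds κ') := hκ'
  have hlim : ∀ (i m : ℕ) (w : Fin m → Fin M), Tendsto (fun n => (μ n).real (window i w)) l
      (nhds ((κ' : Measure (ℕ → Fin M)).real (window i w))) := by
    intro i m w
    have h1 := ProbabilityMeasure.tendsto_measure_of_null_frontier_of_tendsto' hκ
      (E := window i w) (by simp [(isClopen_window i w).frontier_eq])
    exact (ENNReal.tendsto_toReal (measure_ne_top _ _)).comp h1
  have hlim0 : Tendsto (fun n : ℕ => ((n + 1 : ℕ) : ℝ)⁻¹) l (nhds 0) :=
    ((tendsto_inv_atTop_nhds_zero_nat (𝕜 := ℝ)).comp (tendsto_add_atTop_nat 1)).mono_left hl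
  refine ⟨κ', inferInstance, measurePreserving_shift_of_window _ fun m w => ?_, fun m => ?_⟩
  · have h1 := ((hlim 1 m w).sub (hlim 0 m w)).abs
    have h2 := le_of_tendsto_of_tendsto h1 hlim0 (Eventually.of_forall fun n => hinv n m w)
    exact sub_eq_zero.1 (abs_eq_zero.1 (le_antisymm h2 (abs_nonneg _)))
  · have h1 : Tendsto (fun n => windowEntropy (μ n) 0 m + windowEnergy F (μ n) 0 m) l
        (nhds (windowEntropy (κ' : Measure (ℕ → Fin M)) 0 m +
          windowEnergy F (κ' : Measure (ℕ → Fin M)) 0 m)) := by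
      refine Tendsto.add (tendsto_finsetSum _ fun w _ => ?_) (tendsto_finsetSum _ fun w _ => ?_)
      · exact (Real.continuous_negMulLog.tendsto _).comp (hlim 0 m w)
      · exact (hlim 0 m w).mul_const _
    have h2 := h1.add (hlim0.mul_const (m * m * (2 * (Real.log M + C) + C)))
    have h3 := (((hP.comp (tendsto_add_atTop_nat 1)).mono_left hl).const_mul (m : ℝ))
    rw [zero_mul, add_zero] at h2
    refine le_of_tendsto_of_tendsto h3 h2 (hl (eventually_ge_atTop m |>.mono fun n hn => ?_))
    have hn' : (0 : ℝ) < (n + 1 : ℕ) := by positivity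
    have h4 := hle n m (hn.trans (Nat.le_succ n))
    simp only [Function.comp_apply]
    rw [Nat.succ_eq_add_one] at h4
    rw [← mul_div_assoc, div_le_iff₀ hn', add_mul, inv_mul_eq_div, div_mul_cancel₀ _ hn'.ne']
    linarith

/-- Existence of equilibrium states for bounded submultiplicative potentials. -/
theorem exists_equilibrium {M : ℕ} [NeZero M] {F : ∀ n, (Fin n → Fin M) → ℝ} {C P : ℝ}
    (hF : ∀ m n u v, F (m + n) (Fin.append u v) ≤ F m u + F n v)
    (hC : ∀ n w, |F n w| ≤ C * n)
    (hP : Tendsto (fun n : ℕ => logPartition F n / n) atTop (nhds P)) :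
    ∃ μ : Measure (ℕ → Fin M), IsProbabilityMeasure μ ∧ MeasurePreserving shift μ μ ∧
      ∃ h e : ℝ, Tendsto (fun n : ℕ => windowEntropy μ 0 n / n) atTop (nhds h) ∧
        Tendsto (fun n : ℕ => windowEnergy F μ 0 n / n) atTop (nhds e) ∧ P = h + e := by
  obtain ⟨μ, hμ, hinv, hle⟩ := exists_invariant_measure_le hF hC hP
  have hC0 : 0 ≤ C := by simpa using (abs_nonneg _).trans (hC 1 0)
  have hH : ∀ i n, windowEntropy μ i n = windowEntropy μ 0 n := fun i n => by
    simp only [windowEntropy, measureReal_window_of_measurePreserving hinv i]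
  have hE : ∀ i n, windowEnergy F μ i n = windowEnergy F μ 0 n := fun i n => by
    simp only [windowEnergy, measureReal_window_of_measurePreserving hinv i]
  have hHs : Subadditive fun n => windowEntropy μ 0 n := fun m n => by
    simpa only [hH] using windowEntropy_add_le μ 0 m n
  have hEs : Subadditive fun n => windowEnergy F μ 0 n := fun m n => by
    simpa only [hE] using windowEnergy_add_le μ hF 0 m n
  have h1 := hHs.tendsto_lim ⟨0, by
    rintro _ ⟨n, rfl⟩; exact div_nonneg (windowEntropy_nonneg μ 0 n) (Nat.cast_nonneg n)⟩
  have h2 := hEs.tendsto_lim ⟨-C, by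
    rintro _ ⟨n, rfl⟩
    rcases n.eq_zero_or_pos with rfl | hn
    · simpa using hC0
    · have : (0 : ℝ) < n := by exact_mod_cast hn
      rw [le_div_iff₀ this]
      linarith [(abs_le.1 (abs_windowEnergy_le μ hC 0 n)).1]⟩
  -- The first inequality is the bound on all windows, the second the Gibbs inequality.
  refine ⟨μ, hμ, hinv, _, _, h1, h2, le_antisymm ?_ ?_⟩
  · refine ge_of_tendsto (h1.add h2) ((eventually_gt_atTop 0).mono fun n hn => ?_)
    have : (0 : ℝ) < n := by exact_mod_cast hn
    rw [← add_div, le_div_iff₀ this, mul_comm]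
    exact hle n
  · refine le_of_tendsto_of_tendsto' (h1.add h2) hP fun n => ?_
    rw [← add_div]
    exact div_le_div_of_nonneg_right (windowEntropy_add_windowEnergy_le μ 0 n) (Nat.cast_nonneg n)

/-! ### The pressure as a limit and as a function of the exponent -/

/-- The logarithm of the singular value function along words. -/
def logPotential {d M : ℕ} (A : Fin M → GL (Fin d) ℝ) (s : ℝ) (n : ℕ) (w : Fin n → Fin M) : ℝ :=
  Real.log (singularValueFunction s (wordProd A w))

section

variable {d M : ℕ} {A : Fin M → GL (Fin d) ℝ} {s : ℝ}

theorem logPotential_append_le (h0 : 0 ≤ s) (hs : s ≤ d) (m n : ℕ) (u : Fin m → Fin M)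
    (v : Fin n → Fin M) :
    logPotential A s (m + n) (Fin.append u v) ≤ logPotential A s m u + logPotential A s n v := by
  simp only [logPotential, ← coe_wordUnit, wordUnit_append]
  exact log_singularValueFunction_mul_le h0 hs _ _

theorem exp_logPotential (h0 : 0 ≤ s) (hs : s ≤ d) (n : ℕ) (w : Fin n → Fin M) :
    Real.exp (logPotential A s n w) = singularValueFunction s (wordProd A w) := by
  rw [logPotential, Real.exp_log]
  rw [← coe_wordUnit]
  exact singularValueFunction_pos h0 hs _

/-- `pressure` is a `limUnder`, so it carries information only once the limit exists; Fekete's lemma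
supplies it. -/
theorem tendsto_logPartition_pressure [NeZero M] (h0 : 0 ≤ s) (hs : s ≤ d) :
    Tendsto (fun n : ℕ => logPartition (logPotential A s) n / n) atTop (nhds (pressure A s)) := by
  obtain ⟨C, -, hC⟩ := exists_abs_log_singularValueFunction_le A h0 hs
  obtain ⟨P, hP⟩ := exists_tendsto_logPartition (logPotential_append_le (A := A) h0 hs) hC
  have : pressure A s = P := by
    refine Tendsto.limUnder_eq (hP.congr fun n => ?_)
    simp only [logPartition, exp_logPotential h0 hs]
    rw [one_div, inv_mul_eq_div]
  rwa [this]

end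

theorem pressure_zero {d M : ℕ} [NeZero M] (A : Fin M → GL (Fin d) ℝ) :
    pressure A 0 = Real.log M := by
  refine tendsto_nhds_unique (tendsto_logPartition_pressure le_rfl (Nat.cast_nonneg d))
    (tendsto_const_nhds.congr' ((eventually_gt_atTop 0).mono fun n hn => ?_))
  have : (n : ℝ) ≠ 0 := by exact_mod_cast hn.ne'
  rw [eq_div_iff this]
  simp [logPartition, logPotential, singularValueFunction, mul_comm]

theorem logPartition_le_add {M : ℕ} [NeZero M] {F G : ∀ n, (Fin n → Fin M) → ℝ} {n : ℕ} {c : ℝ}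
    (h : ∀ w, F n w ≤ G n w + c) : logPartition F n ≤ logPartition G n + c := by
  rw [logPartition, Real.log_le_iff_le_exp (sum_exp_pos n), Real.exp_add, logPartition,
    Real.exp_log (sum_exp_pos n), Finset.sum_mul]
  refine Finset.sum_le_sum fun w _ => ?_
  rw [← Real.exp_add]
  exact Real.exp_le_exp.2 (h w)

theorem exists_pressure_le_add {d M : ℕ} [NeZero M] (A : Fin M → GL (Fin d) ℝ) :
    ∃ C : ℝ, 0 ≤ C ∧ ∀ s ∈ Set.Icc (0 : ℝ) d, ∀ t ∈ Set.Icc (0 : ℝ) d,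
      pressure A s ≤ pressure A t + C * |s - t| := by
  obtain ⟨C, hC, h⟩ := exists_abs_log_singularValueFunction_sub_le A
  refine ⟨C, hC, fun s hs t ht => ?_⟩
  refine le_of_tendsto_of_tendsto (tendsto_logPartition_pressure hs.1 hs.2)
    ((tendsto_logPartition_pressure ht.1 ht.2).add_const _)
    ((eventually_gt_atTop 0).mono fun n hn => ?_)
  have hn' : (0 : ℝ) < n := by exact_mod_cast hn
  have h1 := logPartition_le_add (F := logPotential A s) (G := logPotential A t) (n := n)
    (c := C * |s - t| * n) fun w => by
      have := (abs_le.1 (h s t hs.1 hs.2 ht.1 ht.2 n w)).2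
      simp only [logPotential]
      linarith
  rwa [div_le_iff₀ hn', add_mul, div_mul_cancel₀ _ hn'.ne']

theorem continuousOn_pressure {d M : ℕ} [NeZero M] (A : Fin M → GL (Fin d) ℝ) :
    ContinuousOn (pressure A) (Set.Icc 0 d) := by
  obtain ⟨C, hC, h⟩ := exists_pressure_le_add A
  refine (LipschitzOnWith.of_dist_le_mul (K := ⟨C, hC⟩) fun s hs t ht => ?_).continuousOn
  rw [Real.dist_eq, Real.dist_eq, abs_le]
  have h1 := h s hs t ht
  have h2 := h t ht s hs
  rw [abs_sub_comm t s] at h2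
  constructor
  · change -(C * |s - t|) ≤ _
    linarith
  · change _ ≤ C * |s - t|
    linarith

/-! ### Deleting a matrix -/

section

variable {d N : ℕ} (A : Fin (N + 1) → GL (Fin d) ℝ) (j : Fin (N + 1))

theorem wordProd_deleteMatrix {n : ℕ} (w : Fin n → Fin N) :
    wordProd (deleteMatrix A j) w = wordProd A fun k => j.succAbove (w k) := rfl

theorem succAbove_comp_injective (n : ℕ) :
    Function.Injective fun (w : Fin n → Fin N) k => j.succAbove (w k) :=
  fun _ _ h => funext fun k => Fin.succAbove_right_injective (congrFun h k)

theorem pressure_deleteMatrix_le [NeZero N] {s : ℝ} (h0 : 0 ≤ s) (hs : s ≤ d) :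
    pressure (deleteMatrix A j) s ≤ pressure A s := by
  refine le_of_tendsto_of_tendsto' (tendsto_logPartition_pressure h0 hs)
    (tendsto_logPartition_pressure h0 hs) fun n => ?_
  refine div_le_div_of_nonneg_right ?_ (Nat.cast_nonneg n)
  refine Real.log_le_log (sum_exp_pos n) ?_
  have h1 := Finset.sum_map Finset.univ
    ⟨fun (w : Fin n → Fin N) k => j.succAbove (w k), succAbove_comp_injective j n⟩
    fun w => Real.exp (logPotential A s n w)
  simp only [logPotential, wordProd_deleteMatrix] at h1 ⊢
  refine h1.symm.le.trans
    (Finset.sum_le_sum_of_subset_of_nonneg (Finset.subset_univ _) fun _ _ _ => (Real.exp_pos _).le)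

/-- The embedding of the infinite words that avoid the letter `j`. -/
def avoidEmbedding (x : ℕ → Fin N) : ℕ → Fin (N + 1) := fun k => j.succAbove (x k)

theorem measurable_avoidEmbedding : Measurable (avoidEmbedding j) :=
  measurable_pi_lambda _ fun n => (Measurable.of_discrete).comp (measurable_pi_apply n)

theorem measurableSet_cylinder {M n : ℕ} (w : Fin n → Fin M) : MeasurableSet (cylinder w) := by
  rw [← window_zero]
  exact measurableSet_window 0 w

variable {j}

theorem measureReal_map_avoidEmbedding (μ : Measure (ℕ → Fin N)) {n : ℕ} (w : Fin n → Fin N) :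
    (μ.map (avoidEmbedding j)).real (cylinder fun k => j.succAbove (w k)) =
      μ.real (window 0 w) := by
  rw [map_measureReal_apply (measurable_avoidEmbedding j) (measurableSet_cylinder _), window_zero]
  congr 1
  ext x
  simp [cylinder, avoidEmbedding]

theorem map_avoidEmbedding_eq_zero (μ : Measure (ℕ → Fin N)) {n : ℕ} {w : Fin n → Fin (N + 1)}
    (hw : w ∉ Set.range fun (v : Fin n → Fin N) k => j.succAbove (v k)) :
    μ.map (avoidEmbedding j) (cylinder w) = 0 := by
  rw [Measure.map_apply (measurable_avoidEmbedding j) (measurableSet_cylinder _)]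
  convert measure_empty (μ := μ)
  refine Set.eq_empty_of_forall_notMem fun x hx => hw ⟨fun k => x k, funext fun k => hx k⟩

/-- Words containing `j` have mass zero, and `g w 0 = 0` removes their terms. One statement serves
both entropy and Lyapunov exponent. -/
theorem sum_map_avoidEmbedding (μ : Measure (ℕ → Fin N)) {n : ℕ}
    {g : (Fin n → Fin (N + 1)) → ℝ → ℝ} (hg : ∀ w, g w 0 = 0) :
    ∑ w : Fin n → Fin (N + 1), g w ((μ.map (avoidEmbedding j)).real (cylinder w)) =
      ∑ w : Fin n → Fin N, g (fun k => j.succAbove (w k)) (μ.real (window 0 w)) := by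
  symm
  refine Finset.sum_of_injOn (fun w k => j.succAbove (w k)) (succAbove_comp_injective j n).injOn
    (by simp) (fun w _ hw => ?_) fun w _ => by rw [measureReal_map_avoidEmbedding]
  rw [Measure.real, map_avoidEmbedding_eq_zero μ (by simpa using hw), ENNReal.toReal_zero, hg]

theorem measurePreserving_map_avoidEmbedding {μ : Measure (ℕ → Fin N)}
    (h : MeasurePreserving shift μ μ) :
    MeasurePreserving shift (μ.map (avoidEmbedding j)) (μ.map (avoidEmbedding j)) := by
  refine ⟨measurable_shift _, ?_⟩
  have h1 : shift ∘ avoidEmbedding j = avoidEmbedding j ∘ shift := rfl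
  rw [Measure.map_map (measurable_shift _) (measurable_avoidEmbedding j), h1,
    ← Measure.map_map (measurable_avoidEmbedding j) (measurable_shift _), h.map_eq]

variable (j)

/-- An equilibrium state of the reduced tuple, seen as a measure for the whole tuple. -/
theorem exists_invariant_not_fullySupported [NeZero N] {s : ℝ} (h0 : 0 ≤ s) (hs : s ≤ d) :
    ∃ μ : Measure (ℕ → Fin (N + 1)), IsProbabilityMeasure μ ∧ MeasurePreserving shift μ μ ∧
      pressure (deleteMatrix A j) s = entropy μ + lyapunov A s μ ∧ ¬ FullySupported μ := by
  obtain ⟨C, -, hC⟩ := exists_abs_log_singularValueFunction_le (deleteMatrix A j) h0 hs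
  obtain ⟨μ, hμ, hinv, h, e, hh, he, hP⟩ := exists_equilibrium
    (logPotential_append_le (A := deleteMatrix A j) h0 hs) hC
    (tendsto_logPartition_pressure h0 hs)
  refine ⟨μ.map (avoidEmbedding j),
    Measure.isProbabilityMeasure_map (measurable_avoidEmbedding j).aemeasurable,
    measurePreserving_map_avoidEmbedding hinv, ?_, fun hfull => ?_⟩
  · have h1 : entropy (μ.map (avoidEmbedding j)) = h := by
      refine Tendsto.limUnder_eq (hh.congr fun n => ?_)
      rw [sum_map_avoidEmbedding μ (g := fun _ x => -(x * Real.log x)) (by simp), one_div,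
        inv_mul_eq_div, windowEntropy]
      simp only [Real.negMulLog_eq_neg]
    have h2 : lyapunov A s (μ.map (avoidEmbedding j)) = e := by
      refine Tendsto.limUnder_eq (he.congr fun n => ?_)
      rw [sum_map_avoidEmbedding μ
        (g := fun w x => x * Real.log (singularValueFunction s (wordProd A w))) (by simp), one_div,
        inv_mul_eq_div]
      rfl
    rw [hP, h1, h2]
  · refine (hfull 1 fun _ => j).ne' (map_avoidEmbedding_eq_zero μ ?_)
    rintro ⟨v, hv⟩
    exact Fin.succAbove_ne j _ (congrFun hv 0)

theorem pressure_deleteMatrix_lt [NeZero N] {s : ℝ} (h0 : 0 ≤ s) (hs : s ≤ d)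
    (h : ∀ μ : Measure (ℕ → Fin (N + 1)), IsEquilibriumState A s μ → FullySupported μ) :
    pressure (deleteMatrix A j) s < pressure A s := by
  refine (pressure_deleteMatrix_le A j h0 hs).lt_of_ne fun heq => ?_
  obtain ⟨μ, hμ, hinv, hP, hn⟩ := exists_invariant_not_fullySupported A j h0 hs
  exact hn (h μ ⟨hμ, hinv, heq ▸ hP⟩)

end

/-! ### Zeros of the pressure and the affinity dimension -/

theorem affinityDim_le {d M : ℕ} {A : Fin M → GL (Fin d) ℝ} {s : ℝ} (h0 : 0 ≤ s) (hs : s ≤ d)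
    (h : pressure A s = 0) : affinityDim A ≤ s := by
  refine csInf_le ⟨0, ?_⟩ (Or.inl ⟨h0, hs, h⟩)
  rintro t (ht | rfl)
  · exact ht.1
  · exact Nat.cast_nonneg d

/-- The pressure at `0` is `log M ≥ 0`, so the intermediate value theorem applies on `[0, s]`. -/
theorem exists_pressure_eq_zero {d M : ℕ} [NeZero M] {A : Fin M → GL (Fin d) ℝ} {s : ℝ}
    (h0 : 0 ≤ s) (hs : s ≤ d) (h : pressure A s ≤ 0) :
    ∃ t, 0 ≤ t ∧ t ≤ s ∧ pressure A t = 0 := by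
  have hc := (continuousOn_pressure A).mono (Set.Icc_subset_Icc_right hs)
  have hp : 0 ≤ pressure A 0 := by
    rw [pressure_zero]
    exact Real.log_natCast_nonneg M
  obtain ⟨t, ht, ht0⟩ := intermediate_value_Icc' h0 hc ⟨h, hp⟩
  exact ⟨t, ht.1, ht.2, ht0⟩

/-- A zero exists, so the extra point `d` does not affect the infimum. The zero set is closed by
continuity, so the infimum is attained. -/
theorem affinityDim_mem {d M : ℕ} [NeZero M] {A : Fin M → GL (Fin d) ℝ}
    (h : pressure A d ≤ 0) :
    0 ≤ affinityDim A ∧ affinityDim A ≤ d ∧ pressure A (affinityDim A) = 0 := by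
  obtain ⟨t, ht0, htd, ht⟩ := exists_pressure_eq_zero (Nat.cast_nonneg d) le_rfl h
  have h1 : affinityDim A = sInf (Set.Icc (0 : ℝ) d ∩ pressure A ⁻¹' {0}) := by
    refine le_antisymm ?_ ?_
    · exact le_csInf ⟨t, ⟨ht0, htd⟩, ht⟩ fun s hs => affinityDim_le hs.1.1 hs.1.2 hs.2
    · refine le_csInf ⟨d, Or.inr rfl⟩ ?_
      have hb : BddBelow (Set.Icc (0 : ℝ) d ∩ pressure A ⁻¹' {0}) := ⟨0, fun s hs => hs.1.1⟩
      rintro s (hs | rfl)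
      · exact csInf_le hb ⟨⟨hs.1, hs.2.1⟩, hs.2.2⟩
      · exact (csInf_le hb ⟨⟨ht0, htd⟩, ht⟩).trans htd
  have h2 : IsClosed (Set.Icc (0 : ℝ) d ∩ pressure A ⁻¹' {0}) :=
    (continuousOn_pressure A).preimage_isClosed_of_isClosed isClosed_Icc isClosed_singleton
  have h3 := h2.csInf_mem ⟨t, ⟨ht0, htd⟩, ht⟩ ⟨0, fun s hs => hs.1.1⟩
  rw [← h1] at h3
  exact ⟨h3.1.1, h3.1.2, h3.2⟩

theorem affinityDim_lt_of_pressure_neg {d M : ℕ} [NeZero M] {A : Fin M → GL (Fin d) ℝ} {s : ℝ}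
    (h0 : 0 ≤ s) (hs : s ≤ d) (h : pressure A s < 0) : affinityDim A < s := by
  obtain ⟨t, ht0, hts, ht⟩ := exists_pressure_eq_zero h0 hs h.le
  refine (affinityDim_le ht0 (hts.trans hs) ht).trans_lt (hts.lt_of_ne fun he => ?_)
  rw [he] at ht
  exact h.ne ht

end AffinityPressure

end

theorem mainTheorem6 (d N : ℕ) (hN : 1 ≤ N) (A : Fin (N + 1) → GL (Fin d) ℝ) (j : Fin (N + 1)) :
    (∀ s : ℝ, 0 ≤ s → s ≤ (d : ℝ) →
      (∀ μ : Measure (ℕ → Fin (N + 1)),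
        AffinityPressure.IsEquilibriumState A s μ → AffinityPressure.FullySupported μ) →
      AffinityPressure.pressure (AffinityPressure.deleteMatrix A j) s
        < AffinityPressure.pressure A s) ∧
    (AffinityPressure.pressure A (d : ℝ) ≤ 0 →
      (∀ μ : Measure (ℕ → Fin (N + 1)),
        AffinityPressure.IsEquilibriumState A (AffinityPressure.affinityDim A) μ →
          AffinityPressure.FullySupported μ) →
      AffinityPressure.affinityDim (AffinityPressure.deleteMatrix A j)
        < AffinityPressure.affinityDim A) := by
  have : NeZero N := ⟨by omega⟩
  refine ⟨fun s h0 hs h => AffinityPressure.pressure_deleteMatrix_lt A j h0 hs h, fun hd h => ?_⟩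
  obtain ⟨h0, hs, hz⟩ := AffinityPressure.affinityDim_mem hd
  refine AffinityPressure.affinityDim_lt_of_pressure_neg h0 hs ?_
  rw [← hz]
  exact AffinityPressure.pressure_deleteMatrix_lt A j h0 hs h
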